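/- Let $D$ be the flat connection of $\mathbb R^4$ and $[\cdot,\cdot,\cdot,\cdot]$ the determinant. Let $N\subset\mathbb R^4$ be a locally strictly convex hyperquadric: the zero set of a polynomial of degree two which is a smooth hypersurface (the differential of the polynomial does not vanish on $N$) and which at each of its points has a locally supporting hyperplane with non-degenerate contact (so, up to an affine map, $N$ is an elliptic paraboloid, an ellipsoid or a hyperboloid of two sheets). Let $\mathfrak G$ be its Blaschke metric, $\mathfrak G(Y,Z)=H(Y,Z)/(\det H(X_i,X_j))^{1/5}$ with $H(Y,Z)=[X_1,X_2,X_3,D_ZY]$ for any tangent frame $X_1,X_2,X_3$ of $N$. Let $M$ be a smooth surface immersed in $\mathbb R^4$ with image in $N$. A metric field on an open set $U\subset M$ is a smooth transversal vector field $\xi$ such that at each point, for a suitable tangent frame $u=(X_1,X_2)$ of $M$, the form $G_u(Y,Z)=[X_1,X_2,D_ZY,\xi]$ is positive definite; its metric is $g_\xi=G_u/(\det G_u(X_i,X_j))^{1/4}$. A smooth transversal plane bundle $\sigma$ over $U$ (so $\mathbb R^4=T_pM\oplus\sigma_p$) induces a connection $\nabla$ on $U$ ($\nabla_XY$ is the tangential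 component of $D_XY$) and shape operators $S_\nu$ ($-S_\nu X$ is the tangential component of $D_X\nu$, for sections $\nu$ of $\sigma$). It is equiaffine for $g=g_\xi$ if $\nabla\omega_g=0$ for the volume form $\omega_g$ of $g$. Write $(\nabla g)(X,Y,Z)=X(g(Y,Z))-g(\nabla_XY,Z)-g(Y,\nabla_XZ)$. An equiaffine $\sigma$ is symmetric if for all local $g$-orthonormal tangent frames $$(\nabla g)(X_2,X_1,X_1)-(\nabla g)(X_1,X_2,X_1)=0,\qquad (\nabla g)(X_1,X_2,X_2)-(\nabla g)(X_2,X_1,X_2)=0,$$ and antisymmetric if $$(\nabla g)(X_2,X_1,X_1)+(\nabla g)(X_1,X_2,X_1)=0,\qquad (\nabla g)(X_1,X_2,X_2)+(\nabla g)(X_2,X_1,X_2)=0.$$ Then every surface $M$ immersed in $N$ is both antisymmetric and symmetric affine semiumbilical with respect to the Blaschke metric of $N$ restricted to $M$. That is: 1. Every point of $M$ has an open neighbourhood $U$ with a metric field $\xi$ on $U$ such that $g_\xi$ is the restriction of $\mathfrak G$ to $U$. 2. For every open $U\subset M$ and every metric field $\xi$ on $U$ such that $g_\xi$ is the restriction of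 $\mathfrak G$ to $U$, there exist an antisymmetric and a symmetric equiaffine plane bundle over $U$ with respect to $g_\xi$; and for every antisymmetric and every symmetric equiaffine plane bundle $\sigma$ over $U$ and every $p\in U$ there is a nonzero $\nu\in\sigma_p$ whose shape operator $S_\nu$ is a multiple of the identity of $T_pM$. -/

import Mathlib

open scoped Manifold ContDiff Topology

noncomputable section

namespace AffineSurface

/-- Affine 4-space. Only its affine and smooth structure and the determinant are used. -/
abbrev A4 : Type := Fin 4 → ℝ

/-- The determinant `[a, b, c, d]`. -/
def bracket (a b c d : A4) : ℝ := Matrix.det (Matrix.of ![a, b, c, d])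

/-! ### Hypersurfaces `N = {φ = 0}` of affine 4-space -/

/-- `φ` is a polynomial of degree two, so that `{φ = 0}` is a hyperquadric. -/
def IsQuadraticPolynomial (φ : A4 → ℝ) : Prop :=
  ∃ (B : LinearMap.BilinForm ℝ A4) (l : A4 →ₗ[ℝ] ℝ) (c : ℝ),
    B.IsSymm ∧ B ≠ 0 ∧ ∀ x, φ x = B x x + l x + c

/-- The tangent hyperplane `T_p N` of the level set `N = {φ = 0}` at a point `p` of `N`. -/
def levelTangent (φ : A4 → ℝ) (p : A4) : Submodule ℝ A4 :=
  LinearMap.ker (fderiv ℝ φ p : A4 →ₗ[ℝ] ℝ)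

/-- The vector of partial derivatives of `φ`. -/
def gradVec (φ : A4 → ℝ) (x : A4) : A4 := fun i => fderiv ℝ φ x (Pi.single i 1)

/-- The vector field `x ↦ (projection of y on T_x N along the vector of partial derivatives)`.
It is tangent to `N`, and it extends `y` whenever `y ∈ T_p N`. -/
def tangentialField (φ : A4 → ℝ) (y : A4) (x : A4) : A4 :=
  y - (fderiv ℝ φ x y / ∑ i, gradVec φ x i ^ 2) • gradVec φ x

/-- `D_z Y` at `p ∈ N`, for a tangent vector field `Y` of `N` with `Y p = y`. Modulo `T_p N` it
depends only on `y` and `z`. -/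
def levelDeriv (φ : A4 → ℝ) (p z y : A4) : A4 := fderiv ℝ (tangentialField φ y) p z

/-- `N = {φ = 0}` is locally strictly convex at `p`: some hyperplane `L (x - p) = 0` supports `N`
near `p`, and its contact with `N` at `p` is non-degenerate, that is, the Hessian
`(y, z) ↦ L (D_z Y)` at the critical point `p` of the restriction of `L` to `N` is
non-degenerate. -/
def IsLocallyStrictlyConvexAt (φ : A4 → ℝ) (p : A4) : Prop :=
  ∃ L : A4 →ₗ[ℝ] ℝ, L ≠ 0 ∧
    (∀ᶠ x in 𝓝[{x | φ x = 0}] p, 0 ≤ L (x - p)) ∧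
    ∀ y ∈ levelTangent φ p, y ≠ 0 → ∃ z ∈ levelTangent φ p, L (levelDeriv φ p z y) ≠ 0

/-- `{φ = 0}` is a locally strictly convex hyperquadric: the zero set of a polynomial of degree
two, smooth and locally strictly convex at each of its points. -/
structure IsLocallyStrictlyConvexHyperquadric (φ : A4 → ℝ) : Prop where
  quadratic : IsQuadraticPolynomial φ
  regular : ∀ p, φ p = 0 → fderiv ℝ φ p ≠ 0
  convex : ∀ p, φ p = 0 → IsLocallyStrictlyConvexAt φ p

/-- The form `H_u(Y, Z) = [X₁, X₂, X₃, D_Z Y]` of a tangent frame `u = (X₁, X₂, X₃)`. -/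
def levelForm (φ : A4 → ℝ) (p : A4) (X : Fin 3 → A4) (y z : A4) : ℝ :=
  bracket (X 0) (X 1) (X 2) (levelDeriv φ p z y)

/-- The real fifth root. -/
def fifthRoot (t : ℝ) : ℝ := (SignType.sign t : ℝ) * |t| ^ (1 / 5 : ℝ)

open Classical in
/-- The Blaschke metric `H_u / (det_u H_u) ^ (1/5)` of `N`, where `u` is a frame of `T_p N`; it does
not depend on the choice of `u`. -/
def blaschkeMetric (φ : A4 → ℝ) (p y z : A4) : ℝ :=
  if h : ∃ X : Fin 3 → A4, LinearIndependent ℝ X ∧ ∀ i, X i ∈ levelTangent φ p then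
    levelForm φ p h.choose y z /
      fifthRoot (Matrix.det (Matrix.of fun i j =>
        levelForm φ p h.choose (h.choose i) (h.choose j)))
  else 0

/-! ### Surfaces immersed in affine 4-space -/

section Surface

variable {M : Type*} [TopologicalSpace M] [ChartedSpace (EuclideanSpace ℝ (Fin 2)) M]

/-- Tangent vector fields on the surface (not necessarily continuous). -/
abbrev Field (M : Type*) [TopologicalSpace M] [ChartedSpace (EuclideanSpace ℝ (Fin 2)) M] :=
  (p : M) → TangentSpace (𝓡 2) p

/-- Families of maps `T_p M × T_p M → ℝ`. -/
abbrev FormField (M : Type*) [TopologicalSpace M] [ChartedSpace (EuclideanSpace ℝ (Fin 2)) M] :=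
  (p : M) → TangentSpace (𝓡 2) p → TangentSpace (𝓡 2) p → ℝ

/-- The derivative at `p` of a vector valued function on the surface, along `x ∈ T_p M`. -/
def deriv4 (F : M → A4) (p : M) (x : TangentSpace (𝓡 2) p) : A4 :=
  mfderiv (𝓡 2) 𝓘(ℝ, A4) F p x

/-- The derivative at `p` of a real function on the surface, along `x ∈ T_p M`. -/
def deriv1 (F : M → ℝ) (p : M) (x : TangentSpace (𝓡 2) p) : ℝ :=
  mfderiv (𝓡 2) 𝓘(ℝ, ℝ) F p x

/-- Smoothness of a vector valued function on a subset of the surface. -/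
def SmoothOn (V : Set M) (F : M → A4) : Prop := ContMDiffOn (𝓡 2) 𝓘(ℝ, A4) ∞ F V

/-- `f` is a smooth immersion of the surface `M` in affine 4-space. -/
structure IsImmersedSurface (f : M → A4) : Prop where
  smooth : ContMDiff (𝓡 2) 𝓘(ℝ, A4) ∞ f
  injective : ∀ p, Function.Injective (mfderiv (𝓡 2) 𝓘(ℝ, A4) f p)

/-- The tangent plane of the immersed surface at `p`, as a plane of vectors of affine 4-space. -/
def tangentPlane (f : M → A4) (p : M) : Submodule ℝ A4 :=
  let df : EuclideanSpace ℝ (Fin 2) →L[ℝ] A4 := mfderiv (𝓡 2) 𝓘(ℝ, A4) f p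
  LinearMap.range (df : EuclideanSpace ℝ (Fin 2) →ₗ[ℝ] A4)

/-- `D_X Y`, where `D` is the flat connection of affine 4-space. -/
def flatD (f : M → A4) (p : M) (x : TangentSpace (𝓡 2) p) (Y : Field M) : A4 :=
  deriv4 (fun q => deriv4 f q (Y q)) p x

section Smooth

variable [IsManifold (𝓡 2) ∞ M]

/-- Smoothness of a tangent vector field on a subset of the surface. -/
def SmoothFieldOn (V : Set M) (X : Field M) : Prop :=
  ContMDiffOn (𝓡 2) (𝓡 2).tangent ∞ (fun p => (⟨p, X p⟩ : TangentBundle (𝓡 2) M)) V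

/-! #### The metric of a transversal vector field -/

/-- The form `G_u(Y, Z) = [X₁, X₂, D_Z Y, ξ]` at `p`, for a frame `u = (x₁, x₂)` of `T_p M`. Here `Y`
is any smooth vector field with `Y p = y`; the value does not depend on it. -/
def transversalForm (f ξ : M → A4) (p : M) (x₁ x₂ y z : TangentSpace (𝓡 2) p) : ℝ :=
  bracket (deriv4 f p x₁) (deriv4 f p x₂)
    (flatD f p z (FiberBundle.extend (EuclideanSpace ℝ (Fin 2)) y)) (ξ p)

/-- `(x₁, x₂)` is a frame of `T_p M` for which `G_u` is positive definite (linear independence of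
`x₁, x₂` follows). -/
def IsPositiveFrame (f ξ : M → A4) (p : M) (x₁ x₂ : TangentSpace (𝓡 2) p) : Prop :=
  ∀ y : TangentSpace (𝓡 2) p, y ≠ 0 → 0 < transversalForm f ξ p x₁ x₂ y y

/-- `ξ` is a metric field on `U`: a smooth transversal vector field with `G_u` positive definite
for suitably oriented frames `u`. -/
structure IsMetricField (f : M → A4) (U : Set M) (ξ : M → A4) : Prop where
  smooth : SmoothOn U ξ
  transversal : ∀ p ∈ U, ξ p ∉ tangentPlane f p
  positive : ∀ p ∈ U, ∃ x₁ x₂ : TangentSpace (𝓡 2) p, IsPositiveFrame f ξ p x₁ x₂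

open Classical in
/-- The metric `g_ξ = G_u / (det_u G_u) ^ (1/4)` of a metric field `ξ`, where `u` is a frame for which
`G_u` is positive definite; it does not depend on the choice of `u`. -/
def transversalMetric (f ξ : M → A4) : FormField M := fun p y z =>
  if h : ∃ u : TangentSpace (𝓡 2) p × TangentSpace (𝓡 2) p, IsPositiveFrame f ξ p u.1 u.2 then
    let u₁ := h.choose.1
    let u₂ := h.choose.2
    let G := transversalForm f ξ p u₁ u₂
    G y z / (G u₁ u₁ * G u₂ u₂ - G u₁ u₂ * G u₂ u₁) ^ (1 / 4 : ℝ)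
  else 0

/-- The restriction to the surface of the Blaschke metric of `{φ = 0}`. -/
def inducedBlaschkeMetric (f : M → A4) (φ : A4 → ℝ) : FormField M := fun p y z =>
  blaschkeMetric φ (f p) (deriv4 f p y) (deriv4 f p z)

/-! #### Transversal plane bundles, induced connection, shape operators -/

/-- `σ` is a smooth transversal plane bundle over `U`. -/
structure IsTransversalPlaneBundle (f : M → A4) (U : Set M) (σ : M → Submodule ℝ A4) : Prop where
  isCompl : ∀ p ∈ U, IsCompl (tangentPlane f p) (σ p)
  smooth : ∀ p ∈ U, ∃ V : Set M, IsOpen V ∧ p ∈ V ∧ V ⊆ U ∧ ∃ ξ₁ ξ₂ : M → A4,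
    SmoothOn V ξ₁ ∧ SmoothOn V ξ₂ ∧ ∀ q ∈ V, σ q = Submodule.span ℝ {ξ₁ q, ξ₂ q}

open Classical in
/-- The tangential component of `w` in the decomposition `T_p M ⊕ σ_p` of affine 4-space, as an
element of `T_p M`. -/
def tangentialPart (f : M → A4) (σ : M → Submodule ℝ A4) (p : M) (w : A4) :
    TangentSpace (𝓡 2) p :=
  if h : ∃ v : TangentSpace (𝓡 2) p, w - deriv4 f p v ∈ σ p then h.choose else 0

/-- The connection `∇` induced by `σ`: the tangential component of `D_X Y`. -/
def inducedConnection (f : M → A4) (σ : M → Submodule ℝ A4) (X Y : Field M) : Field M :=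
  fun p => tangentialPart f σ p (flatD f p (X p) Y)

/-- The shape operator `S_ν` at `p`: minus the tangential component of `D_x ν`. -/
def shapeOperator (f : M → A4) (σ : M → Submodule ℝ A4) (ν : M → A4) (p : M)
    (x : TangentSpace (𝓡 2) p) : TangentSpace (𝓡 2) p :=
  -tangentialPart f σ p (deriv4 ν p x)

/-- `p` is `σ`-semiumbilic: `S_ν` is a multiple of the identity of `T_p M` for some nonzero
`ν ∈ σ_p`, where `ν` is extended to a local smooth section of `σ` in order to define `S_ν`. -/
def IsSemiumbilicAt (f : M → A4) (σ : M → Submodule ℝ A4) (p : M) : Prop :=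
  ∃ (V : Set M) (ν : M → A4), IsOpen V ∧ p ∈ V ∧ SmoothOn V ν ∧ (∀ q ∈ V, ν q ∈ σ q) ∧
    ν p ≠ 0 ∧ ∃ c : ℝ, ∀ x : TangentSpace (𝓡 2) p, shapeOperator f σ ν p x = c • x

/-! #### Equiaffine plane bundles -/

/-- `(∇ g)(X, Y, Z) = X (g(Y, Z)) - g(∇_X Y, Z) - g(Y, ∇_X Z)`. -/
def nablaMetric (f : M → A4) (σ : M → Submodule ℝ A4) (g : FormField M) (X Y Z : Field M)
    (p : M) : ℝ :=
  deriv1 (fun q => g q (Y q) (Z q)) p (X p) -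
    g p (inducedConnection f σ X Y p) (Z p) - g p (Y p) (inducedConnection f σ X Z p)

/-- `(X₁, X₂)` is a smooth `g`-orthonormal tangent frame on `V`. -/
structure IsOrthonormalFrameOn (g : FormField M) (V : Set M) (X₁ X₂ : Field M) : Prop where
  smooth₁ : SmoothFieldOn V X₁
  smooth₂ : SmoothFieldOn V X₂
  unit₁ : ∀ p ∈ V, g p (X₁ p) (X₁ p) = 1
  unit₂ : ∀ p ∈ V, g p (X₂ p) (X₂ p) = 1
  orthogonal : ∀ p ∈ V, g p (X₁ p) (X₂ p) = 0

/-- The volume form `ω_g` of the metric `g`, oriented by the orthonormal frame `(X₁, X₂)`: the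
alternating form with value `1` on this frame. On positively oriented pairs `(y, z)` it is
`√(g(y, y) g(z, z) - g(y, z)²)`. -/
def areaForm (g : FormField M) (X₁ X₂ : Field M) : FormField M := fun p y z =>
  g p y (X₁ p) * g p z (X₂ p) - g p y (X₂ p) * g p z (X₁ p)

/-- `σ` is an equiaffine plane bundle over `U` with respect to `g`: `∇ ω_g = 0`. -/
structure IsEquiaffine (f : M → A4) (U : Set M) (g : FormField M)
    (σ : M → Submodule ℝ A4) : Prop extends IsTransversalPlaneBundle f U σ where
  parallel : ∀ (V : Set M) (X₁ X₂ : Field M), IsOpen V → V ⊆ U → IsOrthonormalFrameOn g V X₁ X₂ →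
    ∀ X Y Z : Field M, SmoothFieldOn V X → SmoothFieldOn V Y → SmoothFieldOn V Z →
      ∀ p ∈ V, nablaMetric f σ (areaForm g X₁ X₂) X Y Z p = 0

/-- Symmetric equiaffine plane bundles over `U`. -/
structure IsSymmetricEquiaffine (f : M → A4) (U : Set M) (g : FormField M)
    (σ : M → Submodule ℝ A4) : Prop extends IsEquiaffine f U g σ where
  symmetric : ∀ (V : Set M) (X₁ X₂ : Field M), IsOpen V → V ⊆ U → IsOrthonormalFrameOn g V X₁ X₂ →
    ∀ p ∈ V,
      nablaMetric f σ g X₂ X₁ X₁ p - nablaMetric f σ g X₁ X₂ X₁ p = 0 ∧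
      nablaMetric f σ g X₁ X₂ X₂ p - nablaMetric f σ g X₂ X₁ X₂ p = 0

/-- Antisymmetric equiaffine plane bundles over `U`. -/
structure IsAntisymmetricEquiaffine (f : M → A4) (U : Set M) (g : FormField M)
    (σ : M → Submodule ℝ A4) : Prop extends IsEquiaffine f U g σ where
  antisymmetric : ∀ (V : Set M) (X₁ X₂ : Field M), IsOpen V → V ⊆ U →
    IsOrthonormalFrameOn g V X₁ X₂ → ∀ p ∈ V,
      nablaMetric f σ g X₂ X₁ X₁ p + nablaMetric f σ g X₁ X₂ X₁ p = 0 ∧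
      nablaMetric f σ g X₁ X₂ X₂ p + nablaMetric f σ g X₂ X₁ X₂ p = 0

/-- The part `U` of the surface is antisymmetric affine semiumbilical with respect to `g`: it
carries an antisymmetric equiaffine plane bundle, and for every such bundle `σ` all points are
`σ`-semiumbilic. -/
def IsAntisymmetricSemiumbilical (f : M → A4) (U : Set M) (g : FormField M) : Prop :=
  (∃ σ, IsAntisymmetricEquiaffine f U g σ) ∧
    ∀ σ, IsAntisymmetricEquiaffine f U g σ → ∀ p ∈ U, IsSemiumbilicAt f σ p

/-- The part `U` of the surface is symmetric affine semiumbilical with respect to `g`: it carries a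
symmetric equiaffine plane bundle, and for every such bundle `σ` all points are
`σ`-semiumbilic. -/
def IsSymmetricSemiumbilical (f : M → A4) (U : Set M) (g : FormField M) : Prop :=
  (∃ σ, IsSymmetricEquiaffine f U g σ) ∧
    ∀ σ, IsSymmetricEquiaffine f U g σ → ∀ p ∈ U, IsSemiumbilicAt f σ p

end Smooth

end Surface

end AffineSurface

end

/-! A hyperquadric carries a Blaschke structure that is affine in the ambient space. Write φ x = x ⬝
S x + l ⬝ x + c, let q be half the gradient of φ, and let d = q ⬝ adj(S) q. On the zero set d is
constant (`halfGrad_adjugate`). A Gram determinant identity (`gram_det_eq`) then shows that the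
Blaschke metric is the restriction of one constant bilinear form β = γ S with γ⁵ d = 1. The matching
conormal is θ₀ - β x, and the affine normal is η = δ x + η₀. Adjugates replace inverses, so the
paraboloid (det S = 0, hence δ = 0) needs no separate treatment. Everything later uses only
`IsBlaschkeData`.

Let e be a local β-unit field tangent to the quadric and normal to M, and let II be the second
fundamental form of M with respect to e. Differentiating the relations between β, the conormal, e
and η gives D_X Y = (tangent part) + II(X, Y) e + g(X, Y) η and D_X η = δ X. Existence in part 1: e
itself is a metric field, and its metric is g. Existence in part 2: the β-orthogonal plane span(e,
η) induces a metric connection, so ∇g = 0 and ∇ω_g = 0, and this bundle is symmetric and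
antisymmetric at once.

Now let σ be any symmetric or antisymmetric equiaffine bundle. Let E and N be the σ-components of e
and η, and put s_i = β(E, X_i), t_i = β(N, X_i). Then ∇g is an explicit expression in II, s and t,
and the conditions on σ become four linear equations. Eliminating t leaves a 2 × 2 system for s
whose determinant is, up to sign, 4b² + (a - c)², where a, b, c are the coefficients of II
(`frame_system`). At a non-umbilic point this forces σ = span(e, η). At an umbilic point, with II =
H g, it only gives η + H e ∈ σ (`mem_of_symmetric_or_antisymmetric`).

Near a non-umbilic point ν = η is therefore a section of σ, with scalar shape operator. At an
umbilic point take ν = η + H e, which is a section of σ near the point whether or not the nearby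
points are umbilic. There D_X ν = (δ - H²) X + dH(X) e, and dH(X) e must lie in σ. Either e ∈ σ at
the point, or e ∉ σ nearby; in the second case all nearby points are umbilic and the Codazzi
equation gives dH = 0. -/

noncomputable section

namespace AffineSurface

/-! ### Linear algebra of a quadratic polynomial on its zero set -/

section QuadricAlgebra

open Matrix

/-- The covector `q` with `dφ_x = 2 q`, for `φ x = x ⬝ S x + l ⬝ x + c`. -/
def halfGrad (S : Matrix (Fin 4) (Fin 4) ℝ) (l : A4) (x : A4) : A4 := S *ᵥ x + (1 / 2 : ℝ) • l

theorem IsQuadraticPolynomial.exists_matrix {φ : A4 → ℝ} (h : IsQuadraticPolynomial φ) :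
    ∃ (S : Matrix (Fin 4) (Fin 4) ℝ) (l : A4) (c : ℝ), S.IsSymm ∧
      ∀ x, φ x = x ⬝ᵥ S *ᵥ x + l ⬝ᵥ x + c := by
  obtain ⟨B, l, c, hB, -, hφ⟩ := h
  refine ⟨LinearMap.BilinForm.toMatrix' B, fun i => l (Pi.single i 1), c, ?_, fun x => ?_⟩
  · ext i j
    simp only [transpose_apply, LinearMap.BilinForm.toMatrix'_apply]
    exact hB.eq _ _
  · rw [hφ]
    congr 2
    · rw [← Matrix.toBilin'_apply', Matrix.toBilin'_toMatrix']
    · conv_lhs => rw [pi_eq_sum_univ' x]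
      simp [dotProduct, mul_comm]

variable {S : Matrix (Fin 4) (Fin 4) ℝ} {l : A4} {c : ℝ} {φ : A4 → ℝ}

theorem dotProduct_mulVec_comm (hS : S.IsSymm) (x y : A4) : x ⬝ᵥ S *ᵥ y = y ⬝ᵥ S *ᵥ x := by
  rw [dotProduct_mulVec, ← mulVec_transpose, hS.eq, dotProduct_comm]

theorem contDiff_quadratic (hφ : ∀ x, φ x = x ⬝ᵥ S *ᵥ x + l ⬝ᵥ x + c) : ContDiff ℝ 1 φ := by
  rw [funext hφ]
  simp only [dotProduct, mulVec]
  fun_prop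

theorem quadratic_add_smul (hS : S.IsSymm) (hφ : ∀ x, φ x = x ⬝ᵥ S *ᵥ x + l ⬝ᵥ x + c) (x y : A4)
    (t : ℝ) :
    φ (x + t • y) = φ x + t * (2 * (halfGrad S l x ⬝ᵥ y)) + t ^ 2 * (y ⬝ᵥ S *ᵥ y) := by
  simp only [hφ, halfGrad, mulVec_add, mulVec_smul, dotProduct_add,
    add_dotProduct, smul_dotProduct, dotProduct_smul, smul_eq_mul,
    dotProduct_mulVec_comm hS y x, dotProduct_comm (S *ᵥ x) y]
  ring

theorem fderiv_quadratic (hS : S.IsSymm)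
    (hφ : ∀ x, φ x = x ⬝ᵥ S *ᵥ x + l ⬝ᵥ x + c) (x y : A4) :
    fderiv ℝ φ x y = 2 * (halfGrad S l x ⬝ᵥ y) := by
  have h1 := ((contDiff_quadratic hφ).differentiable one_ne_zero x).hasFDerivAt
  have h2 : HasDerivAt (fun t : ℝ => φ (x + t • y)) (fderiv ℝ φ x y) 0 := by
    have h := (((hasDerivAt_id (0 : ℝ)).smul_const y).const_add x)
    have h' := h1.comp_hasDerivAt_of_eq (0 : ℝ) h (by simp)
    rwa [one_smul] at h'
  have h3 : HasDerivAt (fun t : ℝ => φ x + t * (2 * (halfGrad S l x ⬝ᵥ y)) + t ^ 2 * (y ⬝ᵥ S *ᵥ y))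
      (2 * (halfGrad S l x ⬝ᵥ y)) 0 := by
    have := (((hasDerivAt_id' (0 : ℝ)).mul_const (2 * (halfGrad S l x ⬝ᵥ y))).const_add (φ x)).fun_add
      (((hasDerivAt_id' (0 : ℝ)).fun_pow 2).mul_const (y ⬝ᵥ S *ᵥ y))
    simpa using this
  simp only [quadratic_add_smul hS hφ] at h2
  exact h2.unique h3

theorem gradVec_quadratic (hS : S.IsSymm)
    (hφ : ∀ x, φ x = x ⬝ᵥ S *ᵥ x + l ⬝ᵥ x + c) (x : A4) :
    gradVec φ x = (2 : ℝ) • halfGrad S l x := by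
  ext i
  simp [gradVec, fderiv_quadratic hS hφ]

/-- `D_z Y` on the quadric `x ⬝ S x + l ⬝ x + c = 0`, in terms of the second fundamental form. -/
theorem levelDeriv_quadratic (hS : S.IsSymm)
    (hφ : ∀ x, φ x = x ⬝ᵥ S *ᵥ x + l ⬝ᵥ x + c) {p : A4} (hp : halfGrad S l p ≠ 0) (z : A4) {y : A4}
    (hy : halfGrad S l p ⬝ᵥ y = 0) :
    levelDeriv φ p z y =
      -((z ⬝ᵥ S *ᵥ y) / (halfGrad S l p ⬝ᵥ halfGrad S l p)) • halfGrad S l p := by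
  have hq : halfGrad S l p ⬝ᵥ halfGrad S l p ≠ 0 := by simpa [dotProduct_self_eq_zero] using hp
  have hfield : tangentialField φ y = fun x =>
      y - ((halfGrad S l x ⬝ᵥ y) / (halfGrad S l x ⬝ᵥ halfGrad S l x)) • halfGrad S l x := by
    funext x
    simp only [tangentialField, gradVec_quadratic hS hφ, fderiv_quadratic hS hφ, smul_smul]
    congr 2
    by_cases h0 : halfGrad S l x = 0
    · simp [h0]
    have hq' : halfGrad S l x ⬝ᵥ halfGrad S l x ≠ 0 := by simpa [dotProduct_self_eq_zero] using h0
    have : (∑ i, ((2 : ℝ) • halfGrad S l x) i ^ 2) =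
        4 * (halfGrad S l x ⬝ᵥ halfGrad S l x) := by
      simp only [dotProduct, Finset.mul_sum, Pi.smul_apply, smul_eq_mul]
      exact Finset.sum_congr rfl fun i _ => by ring
    rw [this]
    field_simp
    ring
  have hgrad : HasFDerivAt (halfGrad S l) (LinearMap.toContinuousLinearMap S.mulVecLin) p :=
    ((LinearMap.toContinuousLinearMap S.mulVecLin).hasFDerivAt).add_const _
  have hnum : HasFDerivAt (fun x => halfGrad S l x ⬝ᵥ y)
      (LinearMap.toContinuousLinearMap ((dotProductBilin ℝ ℝ).flip y) ∘L
        LinearMap.toContinuousLinearMap S.mulVecLin) p :=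
    (LinearMap.toContinuousLinearMap ((dotProductBilin ℝ ℝ).flip y)).hasFDerivAt.comp p hgrad
  have hden : DifferentiableAt ℝ (fun x => (halfGrad S l x ⬝ᵥ halfGrad S l x)⁻¹) p := by
    refine DifferentiableAt.fun_inv ?_ hq
    simp only [dotProduct]
    have : ∀ i, DifferentiableAt ℝ (fun x => halfGrad S l x i) p := fun i =>
      (differentiableAt_pi.1 hgrad.differentiableAt) i
    fun_prop
  have h1 := ((hnum.fun_mul hden.hasFDerivAt).fun_smul hgrad).const_sub y
  rw [levelDeriv, hfield]
  simp only [div_eq_mul_inv]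
  rw [HasFDerivAt.fderiv h1]
  simp [hy, dotProductBilin, dotProduct_comm (S *ᵥ z), dotProduct_mulVec_comm hS y z, mul_comm]

theorem bracket_eq_zero_of_dotProduct {q : A4} (hq : q ≠ 0) {a b c d : A4} (ha : q ⬝ᵥ a = 0)
    (hb : q ⬝ᵥ b = 0) (hc : q ⬝ᵥ c = 0) (hd : q ⬝ᵥ d = 0) : bracket a b c d = 0 := by
  refine Matrix.exists_mulVec_eq_zero_iff.1 ⟨q, hq, ?_⟩
  ext i
  fin_cases i <;> simp [mulVec, dotProduct_comm _ q, *]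

/-- A Gram determinant identity for three vectors orthogonal to the covector `q`. -/
theorem gram_det_eq {q w : A4} {X : Fin 3 → A4} (hX : ∀ i, q ⬝ᵥ X i = 0) :
    (q ⬝ᵥ w) ^ 2 * Matrix.det (Matrix.of fun i j => X i ⬝ᵥ S *ᵥ X j) =
      bracket (X 0) (X 1) (X 2) w ^ 2 * (q ⬝ᵥ S.adjugate *ᵥ q) := by
  set F : Matrix (Fin 4) (Fin 4) ℝ := Matrix.of ![X 0, X 1, X 2, w] with hF
  have hFq : F *ᵥ q = (q ⬝ᵥ w) • Pi.single (3 : Fin 4) 1 := by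
    ext i
    fin_cases i <;> simp [F, mulVec, dotProduct_comm _ q, hX]
  -- Since F q is a multiple of the last basis vector, the last column of adj(F) is proportional to
  -- q; no invertibility of F is needed.
  have h1 : (q ⬝ᵥ w) • (F.adjugate *ᵥ Pi.single (3 : Fin 4) 1) = F.det • q := by
    rw [← mulVec_smul, ← hFq, mulVec_mulVec, adjugate_mul, smul_mulVec, one_mulVec]
  -- The (3, 3) cofactor deletes the row and column of w, leaving the Gram matrix of the X i.
  -- Multiplicativity of the adjugate then expresses it through adj(S).
  have h2 : (F * S * Fᵀ).adjugate 3 3 = Matrix.det (Matrix.of fun i j => X i ⬝ᵥ S *ᵥ X j) := by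
    rw [adjugate_fin_succ_eq_det_submatrix]
    have : ((-1 : ℝ) ^ ((3 : Fin 4) + (3 : Fin 4) : ℕ)) = 1 := by norm_num
    rw [this, one_mul]
    congr 1
    ext i j
    simp only [submatrix_apply, of_apply]
    have hrow : ∀ i : Fin 3, F ((3 : Fin 4).succAbove i) = X i := by
      intro i; fin_cases i <;> rfl
    rw [← hrow i, ← hrow j, Matrix.mul_assoc]
    simp only [Matrix.mul_apply, dotProduct, mulVec, transpose_apply]
  have h3 : (F * S * Fᵀ).adjugate 3 3 = (F.adjugate *ᵥ Pi.single (3 : Fin 4) 1) ⬝ᵥ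
      S.adjugate *ᵥ (F.adjugate *ᵥ Pi.single (3 : Fin 4) 1) := by
    rw [adjugate_mul_distrib, adjugate_mul_distrib, ← adjugate_transpose]
    simp [Matrix.mul_apply, dotProduct, mulVec, Pi.single_apply]
  rw [← h2, h3, bracket, ← hF, pow_two, pow_two]
  have h4 : ∀ (a b : ℝ) (u v : A4), a * b * (u ⬝ᵥ S.adjugate *ᵥ v) =
      (a • u) ⬝ᵥ S.adjugate *ᵥ (b • v) := by
    intro a b u v
    simp [mulVec_smul]
    ring
  rw [h4, h4, h1]

end QuadricAlgebra
end AffineSurface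

/-! ### The fifth root, and definiteness on tangent hyperplanes -/

namespace AffineSurface

theorem fifthRoot_pow (t : ℝ) : fifthRoot t ^ 5 = t := by
  have h5 : (|t| ^ (1 / 5 : ℝ)) ^ 5 = |t| := by
    rw [← Real.rpow_natCast, ← Real.rpow_mul (abs_nonneg t)]
    norm_num
  rw [fifthRoot, mul_pow, h5]
  rcases lt_trichotomy t 0 with h | h | h
  · simp [sign_neg h, abs_of_neg h]
    norm_num
  · simp [h]
  · simp [sign_pos h, abs_of_pos h]

/-- The factor k may be negative, as it is for one of the two orientations of a frame; the real
fifth root is odd, so the sign causes no trouble. -/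
theorem fifthRoot_pow_mul (k t : ℝ) : fifthRoot (k ^ 5 * t) = k * fifthRoot t := by
  have h : Function.Injective fun x : ℝ => x ^ 5 := (Odd.strictMono_pow (by decide)).injective
  apply h
  simp only [mul_pow, fifthRoot_pow]

section QuadricAlgebra

open Matrix

variable {S : Matrix (Fin 4) (Fin 4) ℝ} {l : A4} {c : ℝ} {φ : A4 → ℝ}

/-- Expanding with adj(S) S = det S leaves det S times the quadratic and linear terms of φ, which φ
p = 0 trades for -c. The right side is independent of p, which is why the Blaschke metric has
constant coefficients. -/
theorem halfGrad_adjugate (hS : S.IsSymm) (hφ : ∀ x, φ x = x ⬝ᵥ S *ᵥ x + l ⬝ᵥ x + c) {p : A4}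
    (hp : φ p = 0) :
    halfGrad S l p ⬝ᵥ S.adjugate *ᵥ halfGrad S l p =
      (1 / 4) * (l ⬝ᵥ S.adjugate *ᵥ l) - S.det * c := by
  have h1 : S.adjugate *ᵥ (S *ᵥ p) = S.det • p := by
    rw [mulVec_mulVec, adjugate_mul, smul_mulVec, one_mulVec]
  have h2 : (S *ᵥ p) ⬝ᵥ S.adjugate *ᵥ l = S.det * (l ⬝ᵥ p) := by
    rw [dotProduct_comm, dotProduct_mulVec_comm hS, mulVec_mulVec, mul_adjugate, smul_mulVec,
      one_mulVec, dotProduct_smul, dotProduct_comm, smul_eq_mul]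
  have h3 := hφ p
  rw [hp] at h3
  simp only [halfGrad, mulVec_add, mulVec_smul, dotProduct_add, add_dotProduct, smul_dotProduct,
    dotProduct_smul, h1, h2, smul_eq_mul, dotProduct_comm (S *ᵥ p) p]
  linear_combination -S.det * h3

/-- At a point of local strict convexity the quadratic part is definite on
the tangent hyperplane. -/
theorem exists_definite (hS : S.IsSymm) (hφ : ∀ x, φ x = x ⬝ᵥ S *ᵥ x + l ⬝ᵥ x + c) {p : A4}
    (hp : φ p = 0) (hq : halfGrad S l p ≠ 0) (hconv : IsLocallyStrictlyConvexAt φ p) :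
    ∃ ε : ℝ, ∀ y, halfGrad S l p ⬝ᵥ y = 0 → y ≠ 0 → 0 < ε * (y ⬝ᵥ S *ᵥ y) := by
  obtain ⟨L, hL, hsupp, hnd⟩ := hconv
  set q := halfGrad S l p with hq_def
  have hqq : q ⬝ᵥ q ≠ 0 := by simpa [dotProduct_self_eq_zero] using hq
  have hT : ∀ y, y ∈ levelTangent φ p ↔ q ⬝ᵥ y = 0 := by
    intro y
    simp [levelTangent, fderiv_quadratic hS hφ, hq_def]
  -- Lagrange multipliers: p is an extremum of L on the level set, so L is a multiple of the
  -- differential of φ.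
  obtain ⟨r, hr⟩ : ∃ r : ℝ, ∀ y, L y = r * (q ⬝ᵥ y) := by
    have hextr : IsLocalExtrOn (fun x => L (x - p)) {x | φ x = φ p} p := by
      left
      rw [hp]
      simpa [IsMinFilter] using hsupp
    have hφ' := (contDiff_quadratic hφ).contDiffAt.hasStrictFDerivAt (x := p) one_ne_zero
    have hL' : HasStrictFDerivAt (fun x => L (x - p)) (LinearMap.toContinuousLinearMap L) p := by
      simpa using (LinearMap.toContinuousLinearMap L).hasStrictFDerivAt.comp p
        ((hasStrictFDerivAt_id p).sub_const p)
    obtain ⟨a, b, hab, h⟩ := hextr.exists_multipliers_of_hasStrictFDerivAt_1d hφ' hL'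
    have h' : ∀ y, a * (2 * (q ⬝ᵥ y)) + b * L y = 0 := by
      intro y
      simpa [fderiv_quadratic hS hφ] using congrArg (fun A => A y) h
    have hb : b ≠ 0 := by
      rintro rfl
      have := h' q
      simp only [zero_mul, add_zero, mul_eq_zero, hqq, or_false] at this
      rcases this with h | h
      · exact hab (by simp [h])
      · norm_num at h
    refine ⟨-(2 * a / b), fun y => ?_⟩
    field_simp
    linear_combination h' y
  have hr0 : r ≠ 0 := by
    rintro rfl
    exact hL (LinearMap.ext fun y => by simp [hr])
  have hsemi : ∀ y, q ⬝ᵥ y = 0 → 0 ≤ -r * (y ⬝ᵥ S *ᵥ y) := by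
    intro y hy
    by_cases hy0 : y ⬝ᵥ S *ᵥ y = 0
    · simp [hy0]
    -- Tilt y slightly out of the tangent hyperplane, to y + μ v. The line through p in this
    -- direction meets the quadric again at parameter -2μ / b μ, where L takes the value -2 r μ² / b
    -- μ. Support gives -r b μ ≥ 0 for small μ ≠ 0, and μ → 0 gives the claim.
    set v : A4 := (1 / (q ⬝ᵥ q)) • q
    have hv : q ⬝ᵥ v = 1 := by simp [v, hqq]
    set b : ℝ → ℝ := fun μ => (y + μ • v) ⬝ᵥ S *ᵥ (y + μ • v) with hb
    have hbc : Continuous b := by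
      simp only [hb, dotProduct, mulVec, Pi.add_apply, Pi.smul_apply, smul_eq_mul]
      fun_prop
    have hb0 : b 0 = y ⬝ᵥ S *ᵥ y := by simp [hb]
    have hcurve : ContinuousAt (fun μ => p + (-(2 * μ) / b μ) • (y + μ • v)) 0 := by
      have : b 0 ≠ 0 := by rwa [hb0]
      have hbc' : ContinuousAt b 0 := hbc.continuousAt
      fun_prop (disch := assumption)
    have hev : ∀ᶠ μ in 𝓝 (0 : ℝ), b μ ≠ 0 := hbc.continuousAt.eventually_ne (by rwa [hb0])
    have hmem : ∀ᶠ μ in 𝓝 (0 : ℝ), φ (p + (-(2 * μ) / b μ) • (y + μ • v)) = 0 := by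
      filter_upwards [hev] with μ hμ
      rw [quadratic_add_smul hS hφ, hp, ← hq_def, dotProduct_add, hy, dotProduct_smul, hv,
        smul_eq_mul]
      change 0 + -(2 * μ) / b μ * (2 * (0 + μ * 1)) + (-(2 * μ) / b μ) ^ 2 * b μ = 0
      field_simp
      ring
    have htend : Filter.Tendsto (fun μ => p + (-(2 * μ) / b μ) • (y + μ • v)) (𝓝 0)
        (𝓝[{x | φ x = 0}] p) := by
      refine tendsto_nhdsWithin_iff.2 ⟨?_, hmem⟩
      have := hcurve.tendsto
      simpa using this
    have h1 : ∀ᶠ μ in 𝓝[≠] (0 : ℝ), 0 ≤ -r * b μ := by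
      filter_upwards [(htend.eventually hsupp).filter_mono nhdsWithin_le_nhds,
        hev.filter_mono nhdsWithin_le_nhds, self_mem_nhdsWithin] with μ h1 h2 h3
      rw [hr, add_sub_cancel_left, dotProduct_smul, dotProduct_add, hy, dotProduct_smul, hv] at h1
      simp only [smul_eq_mul, mul_one, zero_add] at h1
      have h3 : 0 < μ ^ 2 := by have : μ ≠ 0 := h3; positivity
      have h4 : 0 < b μ ^ 2 := by positivity
      have h5 : -r * b μ = (r * (-(2 * μ) / b μ * μ)) * (b μ ^ 2 / (2 * μ ^ 2)) := by
        have : μ ≠ 0 := by rintro rfl; simp at h3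
        field_simp
      rw [h5]
      positivity
    have h2 : Filter.Tendsto (fun μ => -r * b μ) (𝓝[≠] 0) (𝓝 (-r * b 0)) :=
      ((hbc.tendsto 0).const_mul _).mono_left nhdsWithin_le_nhds
    rw [← hb0]
    exact ge_of_tendsto h2 h1
  refine ⟨-r, fun y hy hy0 => lt_of_le_of_ne (hsemi y hy) fun h0 => ?_⟩
  obtain ⟨z, hz, hz'⟩ := hnd y ((hT y).2 hy) hy0
  rw [hT] at hz
  apply hz'
  -- A null vector of a semidefinite form lies in its radical, so a null y would contradict the
  -- non-degenerate contact.
  have hyz : z ⬝ᵥ S *ᵥ y = 0 := by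
    have key : ∀ t : ℝ, 0 ≤ t * (2 * (-r * (z ⬝ᵥ S *ᵥ y))) + t ^ 2 * (-r * (z ⬝ᵥ S *ᵥ z)) := by
      intro t
      have := hsemi (y + t • z) (by simp [hy, hz])
      simp only [mulVec_add, mulVec_smul, dotProduct_add, add_dotProduct, smul_dotProduct,
        dotProduct_smul, smul_eq_mul, dotProduct_mulVec_comm hS y z] at this
      linarith
    have : -r * (z ⬝ᵥ S *ᵥ y) = 0 := by
      set a := -r * (z ⬝ᵥ S *ᵥ y)
      set d := -r * (z ⬝ᵥ S *ᵥ z)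
      have hd : 0 ≤ d := hsemi z hz
      -- The shift by 1 in the denominator avoids a separate case d = 0.
      have := key (-a / (d + 1))
      have h1 : -a / (d + 1) * (2 * a) + (-a / (d + 1)) ^ 2 * d =
          -(a ^ 2 * ((d + 2) / (d + 1) ^ 2)) := by
        have : d + 1 ≠ 0 := by positivity
        field_simp
        ring
      rw [h1] at this
      have h2 : 0 < (d + 2) / (d + 1) ^ 2 := by positivity
      by_contra ha
      have : 0 < a ^ 2 := by positivity
      nlinarith
    simpa [hr0] using this
  rw [levelDeriv_quadratic hS hφ hq z hy, hyz]
  simp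

/-- The form ε S has a positive definite Gram matrix on an independent family of tangent vectors;
the cube is the scaling of a 3 × 3 determinant. -/
theorem gram_det_pos {ε : ℝ} {X : Fin 3 → A4} (hS : S.IsSymm) (hX : LinearIndependent ℝ X) {q : A4}
    (hXq : ∀ i, q ⬝ᵥ X i = 0) (hpos : ∀ y, q ⬝ᵥ y = 0 → y ≠ 0 → 0 < ε * (y ⬝ᵥ S *ᵥ y)) :
    0 < ε ^ 3 * Matrix.det (Matrix.of fun i j => X i ⬝ᵥ S *ᵥ X j) := by
  have hPD : (ε • (Matrix.of fun i j => X i ⬝ᵥ S *ᵥ X j)).PosDef := by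
    refine Matrix.PosDef.of_dotProduct_mulVec_pos ?_ fun x hx => ?_
    · ext i j
      simp [dotProduct_mulVec_comm hS (X j)]
    · have h0 : ∑ i, x i • X i ≠ 0 := fun h =>
        hx (funext fun i => Fintype.linearIndependent_iff.1 hX x h i)
      have := hpos _ (by simp [dotProduct_sum, hXq]) h0
      refine lt_of_lt_of_eq this (Eq.symm ?_)
      rw [star_trivial, smul_mulVec, dotProduct_smul, smul_eq_mul]
      congr 1
      generalize hG : (Matrix.of fun i j => X i ⬝ᵥ S *ᵥ X j) = G
      have hG' : ∀ i j, X i ⬝ᵥ S *ᵥ X j = G i j := by simp [← hG]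
      simp only [Fin.sum_univ_three, mulVec_add, mulVec_smul, add_dotProduct,
        dotProduct_add, smul_dotProduct, dotProduct_smul, smul_eq_mul, hG']
      simp only [mulVec, dotProduct, Fin.sum_univ_three]
      ring
  have := hPD.det_pos
  rwa [Matrix.det_smul, Fintype.card_fin] at this

end QuadricAlgebra
end AffineSurface

/-! ### The Blaschke structure of a hyperquadric -/

namespace AffineSurface

/-- An affine field of conormals `θ₀ - β x`. -/
def conormal (β : A4 →L[ℝ] A4 →L[ℝ] ℝ) (θ₀ : A4 →L[ℝ] ℝ) (x : A4) : A4 →L[ℝ] ℝ := θ₀ - β x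

/-- An affine field of vectors `δ x + η₀`. -/
def affineNormal (δ : ℝ) (η₀ : A4) (x : A4) : A4 := δ • x + η₀

/-- The Blaschke structure of the hyperquadric `{φ = 0}`: its Blaschke metric is the restriction of
the constant form `β`, and its affine normal is `δ x + η₀`, which is `β`-orthogonal to the tangent
hyperplanes, the kernels of `θ₀ - β x`. -/
structure IsBlaschkeData (φ : A4 → ℝ) (β : A4 →L[ℝ] A4 →L[ℝ] ℝ) (θ₀ : A4 →L[ℝ] ℝ) (δ : ℝ)
    (η₀ : A4) : Prop where
  symm : ∀ y z, β y z = β z y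
  differentiable : Differentiable ℝ φ
  ker_fderiv : ∀ x, φ x = 0 → ∀ y, fderiv ℝ φ x y = 0 ↔ conormal β θ₀ x y = 0
  conormal_normal : ∀ x, φ x = 0 → conormal β θ₀ x (affineNormal δ η₀ x) = 1
  orthogonal : ∀ x, φ x = 0 → ∀ y, conormal β θ₀ x y = 0 → β (affineNormal δ η₀ x) y = 0
  pos : ∀ x, φ x = 0 → ∀ y, conormal β θ₀ x y = 0 → y ≠ 0 → 0 < β y y
  gram : ∀ x, φ x = 0 → ∀ X : Fin 3 → A4, (∀ i, conormal β θ₀ x (X i) = 0) →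
    Matrix.det (Matrix.of fun i j => β (X i) (X j)) =
      bracket (X 0) (X 1) (X 2) (affineNormal δ η₀ x) ^ 2
  metric : ∀ x, φ x = 0 → ∀ y z, conormal β θ₀ x y = 0 → conormal β θ₀ x z = 0 →
    blaschkeMetric φ x y z = β y z

section QuadricAlgebra

open Matrix

variable {S : Matrix (Fin 4) (Fin 4) ℝ} {l : A4} {c : ℝ} {φ : A4 → ℝ}

theorem mem_levelTangent_quadratic (hS : S.IsSymm)
    (hφ : ∀ x, φ x = x ⬝ᵥ S *ᵥ x + l ⬝ᵥ x + c) (p y : A4) :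
    y ∈ levelTangent φ p ↔ halfGrad S l p ⬝ᵥ y = 0 := by
  simp [levelTangent, fderiv_quadratic hS hφ]

theorem exists_levelTangent_frame (hS : S.IsSymm)
    (hφ : ∀ x, φ x = x ⬝ᵥ S *ᵥ x + l ⬝ᵥ x + c) {p : A4} (hq : halfGrad S l p ≠ 0) :
    ∃ X : Fin 3 → A4, LinearIndependent ℝ X ∧ ∀ i, X i ∈ levelTangent φ p := by
  have hqq : halfGrad S l p ⬝ᵥ halfGrad S l p ≠ 0 := by simpa [dotProduct_self_eq_zero] using hq
  have hne : (fderiv ℝ φ p : A4 →ₗ[ℝ] ℝ) ≠ 0 := by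
    intro h
    have h' := congrArg (fun A => A (halfGrad S l p)) h
    simp [fderiv_quadratic hS hφ] at h'
    exact hqq (by simpa [dotProduct_self_eq_zero] using h')
  have hfin : Module.finrank ℝ (levelTangent φ p) = 3 := by
    have h1 := LinearMap.finrank_range_add_finrank_ker (fderiv ℝ φ p : A4 →ₗ[ℝ] ℝ)
    rw [LinearMap.range_eq_top.2 (LinearMap.surjective hne), finrank_top, Module.finrank_self,
      Module.finrank_fin_fun] at h1
    rw [levelTangent]
    omega
  let b := Module.finBasisOfFinrankEq ℝ (levelTangent φ p) hfin
  exact ⟨fun i => b i, b.linearIndependent.map' (levelTangent φ p).subtype (Submodule.ker_subtype _),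
    fun i => (b i).2⟩

/-- In a tangent frame the form H is k S, where k depends on the frame, and the Gram determinant of
S is k² d. So det H = k⁵ d, and its fifth root cancels k. -/
theorem blaschkeMetric_quadratic (hS : S.IsSymm)
    (hφ : ∀ x, φ x = x ⬝ᵥ S *ᵥ x + l ⬝ᵥ x + c) {p : A4} (hq : halfGrad S l p ≠ 0) {d : ℝ}
    (hd : halfGrad S l p ⬝ᵥ S.adjugate *ᵥ halfGrad S l p = d)
    (hgram : ∀ X : Fin 3 → A4, LinearIndependent ℝ X → (∀ i, halfGrad S l p ⬝ᵥ X i = 0) →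
      Matrix.det (Matrix.of fun i j => X i ⬝ᵥ S *ᵥ X j) ≠ 0)
    {y z : A4} (hy : halfGrad S l p ⬝ᵥ y = 0) :
    blaschkeMetric φ p y z = (fifthRoot d)⁻¹ * (y ⬝ᵥ S *ᵥ z) := by
  have hqq : halfGrad S l p ⬝ᵥ halfGrad S l p ≠ 0 := by simpa [dotProduct_self_eq_zero] using hq
  have h := exists_levelTangent_frame hS hφ hq
  rw [blaschkeMetric, dif_pos h]
  obtain ⟨hX, hXt⟩ := h.choose_spec
  set X := h.choose
  simp only [mem_levelTangent_quadratic hS hφ] at hXt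
  set q := halfGrad S l p with hq_def
  set k : ℝ := -(bracket (X 0) (X 1) (X 2) q / (q ⬝ᵥ q)) with hk
  have hform : ∀ y z, q ⬝ᵥ y = 0 → levelForm φ p X y z = k * (y ⬝ᵥ S *ᵥ z) := by
    intro y z hy
    have hsmul : ∀ (t : ℝ) (w : A4), bracket (X 0) (X 1) (X 2) (t • w) =
        t * bracket (X 0) (X 1) (X 2) w := by
      intro t w
      have := Matrix.det_updateRow_smul (Matrix.of ![X 0, X 1, X 2, w]) 3 t w
      have e : ∀ v : A4, (Matrix.of ![X 0, X 1, X 2, w]).updateRow 3 v =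
          Matrix.of ![X 0, X 1, X 2, v] := by
        intro v
        ext i j
        fin_cases i <;> simp [Matrix.updateRow_apply]
      rw [e, e] at this
      exact this
    rw [levelForm, levelDeriv_quadratic hS hφ hq z hy, hsmul, hk, dotProduct_mulVec_comm hS y z]
    ring
  have hdet : Matrix.det (Matrix.of fun i j => levelForm φ p X (X i) (X j)) =
      k ^ 3 * Matrix.det (Matrix.of fun i j => X i ⬝ᵥ S *ᵥ X j) := by
    have : (Matrix.of fun i j => levelForm φ p X (X i) (X j)) =
        k • (Matrix.of fun i j => X i ⬝ᵥ S *ᵥ X j) := by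
      ext i j
      simp [hform _ _ (hXt i)]
    rw [this, Matrix.det_smul, Fintype.card_fin]
  -- The choice w = q makes both the bracket in k and the factor q ⬝ q appear.
  have hg := gram_det_eq (S := S) (w := q) hXt
  rw [hd] at hg
  have hg' : Matrix.det (Matrix.of fun i j => X i ⬝ᵥ S *ᵥ X j) = k ^ 2 * d := by
    rw [hk]
    field_simp
    linear_combination hg
  have hne := hgram X hX hXt
  rw [hg'] at hne
  have hk0 : k ≠ 0 := by rintro h; simp [h] at hne
  rw [hform y z hy, hdet, hg', show k ^ 3 * (k ^ 2 * d) = k ^ 5 * d by ring, fifthRoot_pow_mul]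
  field_simp

end QuadricAlgebra

-- The conormal is -γ q and the affine normal is -(1 / (γ d)) adj(S) q. Orthogonality to tangent
-- vectors is S adj(S) = det S, the normalisation is q ⬝ adj(S) q = d, and the volume condition is
-- γ⁵ d = 1. A point of the quadric is needed to know d ≠ 0.
open Matrix in
theorem IsLocallyStrictlyConvexHyperquadric.exists_blaschkeData {φ : A4 → ℝ}
    (hφ : IsLocallyStrictlyConvexHyperquadric φ) (hne : ∃ x, φ x = 0) :
    ∃ β θ₀ δ η₀, IsBlaschkeData φ β θ₀ δ η₀ := by
  obtain ⟨S, l, c, hS, hφS⟩ := hφ.quadratic.exists_matrix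
  set d := (1 / 4) * (l ⬝ᵥ S.adjugate *ᵥ l) - S.det * c with hd
  have hq : ∀ x, φ x = 0 → halfGrad S l x ≠ 0 := by
    intro x hx h
    exact hφ.regular x hx (ContinuousLinearMap.ext fun y => by simp [fderiv_quadratic hS hφS, h])
  have hgram : ∀ x, φ x = 0 → ∀ y, halfGrad S l x ⬝ᵥ y = 0 → y ≠ 0 → 0 < d * (y ⬝ᵥ S *ᵥ y) := by
    intro x hx
    obtain ⟨ε, hε⟩ := exists_definite hS hφS hx (hq x hx) (hφ.convex x hx)
    obtain ⟨X, hX, hXt⟩ := exists_levelTangent_frame hS hφS (hq x hx)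
    simp only [mem_levelTangent_quadratic hS hφS] at hXt
    have h1 := gram_det_pos hS hX hXt hε
    have h2 := gram_det_eq (S := S) (w := halfGrad S l x) hXt
    rw [halfGrad_adjugate hS hφS hx, ← hd] at h2
    have hqq : 0 < (halfGrad S l x ⬝ᵥ halfGrad S l x) ^ 2 := by
      have : halfGrad S l x ⬝ᵥ halfGrad S l x ≠ 0 := by
        simpa [dotProduct_self_eq_zero] using hq x hx
      positivity
    -- The Gram identity compares signs: the ε of local convexity, which may depend on x, always has
    -- the sign of d. Hence d S is positive definite on every tangent hyperplane.
    have h3 : 0 < ε ^ 3 * d := by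
      have : 0 < bracket (X 0) (X 1) (X 2) (halfGrad S l x) ^ 2 * (ε ^ 3 * d) := by
        have := mul_pos hqq h1
        rw [mul_left_comm, h2] at this
        linarith
      exact pos_of_mul_pos_right this (sq_nonneg _)
    have h4 : 0 < ε * d := by
      have : 0 < ε ^ 2 * (ε * d) := by linarith
      exact pos_of_mul_pos_right this (sq_nonneg _)
    intro y hy hy0
    have h5 := mul_pos h4 (hε y hy hy0)
    have : 0 < ε ^ 2 * (d * (y ⬝ᵥ S *ᵥ y)) := by linarith
    exact pos_of_mul_pos_right this (sq_nonneg _)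
  set γ := (fifthRoot d)⁻¹ with hγ
  have hd0 : d ≠ 0 := by
    obtain ⟨x, hx⟩ := hne
    obtain ⟨X, hX, hXt⟩ := exists_levelTangent_frame hS hφS (hq x hx)
    intro h
    simpa [h] using hgram x hx (X 0) ((mem_levelTangent_quadratic hS hφS _ _).1 (hXt 0)) (hX.ne_zero 0)
  have hγ5 : γ ^ 5 * d = 1 := by
    rw [hγ, inv_pow, fifthRoot_pow, inv_mul_cancel₀ hd0]
  have hγ0 : γ ≠ 0 := by rintro h; simp [h] at hγ5
  have hγd : 0 < γ * d := by
    have : 0 < γ ^ 4 * (γ * d) := by nlinarith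
    exact pos_of_mul_pos_right this (by positivity)
  set β : A4 →L[ℝ] A4 →L[ℝ] ℝ := (γ • Matrix.toBilin' S).toContinuousBilinearMap with hβ_def
  have hβ : ∀ y z, β y z = γ * (y ⬝ᵥ S *ᵥ z) := by
    intro y z
    simp [hβ_def, Matrix.toBilin'_apply']
  set θ₀ : A4 →L[ℝ] ℝ := LinearMap.toContinuousLinearMap
    (dotProductBilin ℝ ℝ ((-(γ / 2)) • l)) with hθ_def
  have hθ : ∀ x y, conormal β θ₀ x y = -γ * (halfGrad S l x ⬝ᵥ y) := by
    intro x y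
    have h0 : θ₀ y = -(γ / 2) * (l ⬝ᵥ y) := by simp [hθ_def, dotProductBilin]
    simp only [conormal, _root_.sub_apply, hβ, h0, halfGrad, add_dotProduct, smul_dotProduct,
      smul_eq_mul, dotProduct_mulVec_comm hS x y, dotProduct_comm (S *ᵥ x) y]
    ring
  have hθ0 : ∀ x y, conormal β θ₀ x y = 0 ↔ halfGrad S l x ⬝ᵥ y = 0 := by
    intro x y
    simp [hθ, hγ0]
  set δ : ℝ := -(S.det / (γ * d)) with hδ
  set η₀ : A4 := -(1 / (2 * (γ * d))) • S.adjugate *ᵥ l with hη₀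
  set η : A4 → A4 := affineNormal δ η₀
  have hη : ∀ x, η x = -(1 / (γ * d)) • S.adjugate *ᵥ halfGrad S l x := by
    intro x
    have h1 : S.adjugate *ᵥ (S *ᵥ x) = S.det • x := by
      rw [mulVec_mulVec, adjugate_mul, smul_mulVec, one_mulVec]
    simp only [η, δ, η₀, affineNormal, halfGrad, mulVec_add, mulVec_smul, h1, smul_add, smul_smul]
    congr 2 <;> field_simp
  have hηq : ∀ x, φ x = 0 → halfGrad S l x ⬝ᵥ η x = -(1 / γ) := by
    intro x hx
    rw [hη, dotProduct_smul, halfGrad_adjugate hS hφS hx, ← hd, smul_eq_mul]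
    field_simp
  have hgram' : ∀ x, φ x = 0 → ∀ X : Fin 3 → A4, LinearIndependent ℝ X →
      (∀ i, halfGrad S l x ⬝ᵥ X i = 0) →
      Matrix.det (Matrix.of fun i j => X i ⬝ᵥ S *ᵥ X j) ≠ 0 := by
    intro x hx X hX hXq h
    simpa [h] using gram_det_pos hS hX hXq (hgram x hx)
  refine ⟨β, θ₀, δ, η₀, ?_⟩
  constructor
  · intro y z
    rw [hβ, hβ, dotProduct_mulVec_comm hS]
  · exact (contDiff_quadratic hφS).differentiable one_ne_zero
  · intro x hx y
    simp [hθ0, fderiv_quadratic hS hφS]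
  · intro x hx
    change conormal β θ₀ x (η x) = 1
    rw [hθ, hηq x hx]
    field_simp
  · intro x hx y hy
    change β (η x) y = 0
    rw [hθ0] at hy
    rw [hβ, dotProduct_mulVec_comm hS, hη, mulVec_smul, mulVec_mulVec, mul_adjugate, smul_mulVec,
      one_mulVec, dotProduct_smul, dotProduct_smul, dotProduct_comm, hy]
    simp
  · intro x hx y hy hy0
    rw [hθ0] at hy
    rw [hβ]
    have := hgram x hx y hy hy0
    have h2 := mul_pos hγd this
    have : 0 < d ^ 2 * (γ * (y ⬝ᵥ S *ᵥ y)) := by linarith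
    exact pos_of_mul_pos_right this (sq_nonneg _)
  · intro x hx X hX
    simp only [hθ0] at hX
    have h1 := gram_det_eq (S := S) (w := η x) hX
    rw [hηq x hx, halfGrad_adjugate hS hφS hx, ← hd] at h1
    have h2 : (Matrix.of fun i j => β (X i) (X j)) =
        γ • (Matrix.of fun i j => X i ⬝ᵥ S *ᵥ X j) := by
      ext i j
      simp [hβ]
    rw [h2, Matrix.det_smul, Fintype.card_fin]
    change _ = bracket (X 0) (X 1) (X 2) (η x) ^ 2
    -- The factor (q ⬝ η)² = γ⁻² in the Gram identity with w = η is what is cancelled here.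
    have h3 : γ ^ 2 * (-(1 / γ)) ^ 2 = 1 := by field_simp
    linear_combination γ ^ 5 * h1 + bracket (X 0) (X 1) (X 2) (η x) ^ 2 * hγ5 -
      γ ^ 3 * Matrix.det (Matrix.of fun i j => X i ⬝ᵥ S *ᵥ X j) * h3
  · intro x hx y z hy hz
    rw [hθ0] at hy
    rw [blaschkeMetric_quadratic hS hφS (hq x hx) (halfGrad_adjugate hS hφS hx) (hgram' x hx) hy,
      hβ]

end AffineSurface

/-! ### Differential calculus on the surface for vector valued functions -/

namespace AffineSurface

section Calculus

variable {M : Type*} [TopologicalSpace M] [ChartedSpace (EuclideanSpace ℝ (Fin 2)) M]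
  {W W₁ W₂ W₃ : Type*} [NormedAddCommGroup W] [NormedSpace ℝ W] [NormedAddCommGroup W₁]
  [NormedSpace ℝ W₁] [NormedAddCommGroup W₂] [NormedSpace ℝ W₂] [NormedAddCommGroup W₃]
  [NormedSpace ℝ W₃]

/-- The derivative at `p` along `x` of a vector valued function on the surface. -/
def derivAlong (F : M → W) (p : M) (x : TangentSpace (𝓡 2) p) : W :=
  mfderiv (𝓡 2) 𝓘(ℝ, W) F p x

theorem derivAlong_eq_of_hasMFDerivAt {F : M → W} {p : M} {L : EuclideanSpace ℝ (Fin 2) →L[ℝ] W}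
    (h : HasMFDerivAt (𝓡 2) 𝓘(ℝ, W) F p L) (x : TangentSpace (𝓡 2) p) :
    derivAlong F p x = L x := by
  have := h.mfderiv
  exact congrArg (fun A : EuclideanSpace ℝ (Fin 2) →L[ℝ] W => A x) this

theorem derivAlong_bilinear (B : W₁ →L[ℝ] W₂ →L[ℝ] W₃) {F : M → W₁} {G : M → W₂} {p : M}
    (hF : MDifferentiableAt (𝓡 2) 𝓘(ℝ, W₁) F p) (hG : MDifferentiableAt (𝓡 2) 𝓘(ℝ, W₂) G p)
    (x : TangentSpace (𝓡 2) p) :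
    derivAlong (fun q => B (F q) (G q)) p x =
      B (derivAlong F p x) (G p) + B (F p) (derivAlong G p x) := by
  have hc : ContinuousAt (fun q => B (F q) (G q)) p := by
    have := hF.continuousAt
    have := hG.continuousAt
    fun_prop
  have h3 := B.hasFDerivWithinAt_of_bilinear hF.hasMFDerivAt.2 hG.hasMFDerivAt.2
  rw [derivAlong_eq_of_hasMFDerivAt ⟨hc, h3⟩]
  have h1 : writtenInExtChartAt (𝓡 2) 𝓘(ℝ, W₁) p F (extChartAt (𝓡 2) p p) = F p := by
    change F ((extChartAt (𝓡 2) p).symm (extChartAt (𝓡 2) p p)) = F p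
    rw [extChartAt_to_inv]
  have h2 : writtenInExtChartAt (𝓡 2) 𝓘(ℝ, W₂) p G (extChartAt (𝓡 2) p p) = G p := by
    change G ((extChartAt (𝓡 2) p).symm (extChartAt (𝓡 2) p p)) = G p
    rw [extChartAt_to_inv]
  rw [h1, h2]
  exact add_comm _ _

theorem derivAlong_clm (A : W₁ →L[ℝ] W₂) {F : M → W₁} {p : M}
    (hF : MDifferentiableAt (𝓡 2) 𝓘(ℝ, W₁) F p) (x : TangentSpace (𝓡 2) p) :
    derivAlong (fun q => A (F q)) p x = A (derivAlong F p x) :=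
  derivAlong_eq_of_hasMFDerivAt ((A.hasMFDerivAt (x := F p)).comp p hF.hasMFDerivAt) x

theorem derivAlong_congr {F G : M → W} {p : M} (h : F =ᶠ[𝓝 p] G) (x : TangentSpace (𝓡 2) p) :
    derivAlong F p x = derivAlong G p x :=
  congrArg (fun A : EuclideanSpace ℝ (Fin 2) →L[ℝ] W => A x) h.mfderiv_eq

theorem derivAlong_const (w : W) (p : M) (x : TangentSpace (𝓡 2) p) :
    derivAlong (fun _ => w) p x = 0 :=
  derivAlong_eq_of_hasMFDerivAt (hasMFDerivAt_const w p) x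

theorem derivAlong_add {F G : M → W} {p : M}
    (hF : MDifferentiableAt (𝓡 2) 𝓘(ℝ, W) F p) (hG : MDifferentiableAt (𝓡 2) 𝓘(ℝ, W) G p)
    (x : TangentSpace (𝓡 2) p) :
    derivAlong (fun q => F q + G q) p x = derivAlong F p x + derivAlong G p x :=
  derivAlong_eq_of_hasMFDerivAt (hF.hasMFDerivAt.add hG.hasMFDerivAt) x

theorem derivAlong_sub {F G : M → W} {p : M}
    (hF : MDifferentiableAt (𝓡 2) 𝓘(ℝ, W) F p) (hG : MDifferentiableAt (𝓡 2) 𝓘(ℝ, W) G p)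
    (x : TangentSpace (𝓡 2) p) :
    derivAlong (fun q => F q - G q) p x = derivAlong F p x - derivAlong G p x :=
  derivAlong_eq_of_hasMFDerivAt (hF.hasMFDerivAt.sub hG.hasMFDerivAt) x

variable [IsManifold (𝓡 2) ∞ M]

/-- The function is the fibre component of the tangent map of F composed with the section X. -/
theorem contMDiffOn_derivAlong {V : Set M} (hV : IsOpen V) {F : M → W}
    (hF : ContMDiffOn (𝓡 2) 𝓘(ℝ, W) ∞ F V) {X : Field M} (hX : SmoothFieldOn V X) :
    ContMDiffOn (𝓡 2) 𝓘(ℝ, W) ∞ (fun q => derivAlong F q (X q)) V := by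
  have h1 := hF.contMDiffOn_tangentMapWithin (m := ∞) (by simp) hV.uniqueMDiffOn
  have h2 := h1.comp hX (fun q hq => hq)
  have h3 := (contMDiff_snd_tangentBundle_modelSpace W 𝓘(ℝ, W) (n := ∞)).comp_contMDiffOn h2
  refine h3.congr fun q hq => ?_
  simp only [derivAlong, Function.comp, tangentMapWithin]
  rw [mfderivWithin_of_isOpen hV hq]

/-- The extension of y is constant in the chart at p, so differentiating along it is an ordinary
directional derivative of F read in that chart. -/
theorem derivAlong_extend {F : M → W} {p q : M} (hq : q ∈ (chartAt (EuclideanSpace ℝ (Fin 2)) p).source)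
    (hF : MDifferentiableAt (𝓡 2) 𝓘(ℝ, W) F q) (y : TangentSpace (𝓡 2) p) :
    derivAlong F q (FiberBundle.extend (EuclideanSpace ℝ (Fin 2)) y q) =
      fderiv ℝ (F ∘ (extChartAt (𝓡 2) p).symm) (extChartAt (𝓡 2) p q)
        (trivializationAt (EuclideanSpace ℝ (Fin 2)) (TangentSpace (𝓡 2)) p ⟨p, y⟩).2 := by
  set φ := extChartAt (𝓡 2) p
  set t := trivializationAt (EuclideanSpace ℝ (Fin 2)) (TangentSpace (𝓡 2) : M → Type _) p
  set w := (t ⟨p, y⟩).2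
  have hqφ : q ∈ φ.source := by rwa [extChartAt_source]
  obtain ⟨L, hL⟩ : ∃ L : EuclideanSpace ℝ (Fin 2) →L[ℝ] W, HasMFDerivAt (𝓡 2) 𝓘(ℝ, W) F q L :=
    ⟨_, hF.hasMFDerivAt⟩
  obtain ⟨A, hA, hAw⟩ : ∃ A : EuclideanSpace ℝ (Fin 2) →L[ℝ] EuclideanSpace ℝ (Fin 2),
      HasMFDerivWithinAt 𝓘(ℝ, EuclideanSpace ℝ (Fin 2)) (𝓡 2) φ.symm (Set.range (𝓡 2)) (φ q) A ∧
      FiberBundle.extend (EuclideanSpace ℝ (Fin 2)) y q = A w := by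
    refine ⟨_, (mdifferentiableWithinAt_extChartAt_symm (φ.map_source hqφ)).hasMFDerivWithinAt, ?_⟩
    have h := congrArg (fun A : EuclideanSpace ℝ (Fin 2) →L[ℝ] TangentSpace (𝓡 2) q => A w)
      (TangentBundle.symmL_trivializationAt (I := 𝓡 2) hq)
    rw [Bundle.Trivialization.symmL_apply _ (by simpa using hq)] at h
    exact h
  have hL' : HasMFDerivAt (𝓡 2) 𝓘(ℝ, W) F (φ.symm (φ q)) L := by
    rw [φ.left_inv hqφ]
    exact hL
  have h4 := hL'.comp_hasMFDerivWithinAt _ hA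
  rw [ModelWithCorners.Boundaryless.range_eq_univ, hasMFDerivWithinAt_univ] at h4
  have h5 : HasFDerivAt (F ∘ φ.symm) (L.comp A) (φ q) := hasMFDerivAt_iff_hasFDerivAt.1 h4
  rw [derivAlong_eq_of_hasMFDerivAt hL, h5.fderiv, hAw]
  rfl

/-- Both sides are the second Fréchet derivative of F in the chart at p, because the extended fields
have constant coordinates. This is the source of the symmetry of II and of the Codazzi equation. -/
theorem derivAlong_derivAlong_comm {F : M → W} {p : M}
    (hF : ContMDiffAt (𝓡 2) 𝓘(ℝ, W) ∞ F p) (y z : TangentSpace (𝓡 2) p) :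
    derivAlong (fun q => derivAlong F q (FiberBundle.extend (EuclideanSpace ℝ (Fin 2)) y q)) p z =
    derivAlong (fun q => derivAlong F q (FiberBundle.extend (EuclideanSpace ℝ (Fin 2)) z q)) p y := by
  set φ := extChartAt (𝓡 2) p with hφ
  set w : TangentSpace (𝓡 2) p → EuclideanSpace ℝ (Fin 2) := fun y =>
    (trivializationAt (EuclideanSpace ℝ (Fin 2)) (TangentSpace (𝓡 2)) p ⟨p, y⟩).2
  have hFφ : ContDiffAt ℝ ∞ (F ∘ φ.symm) (φ p) := by
    have h1 : ContMDiffAt 𝓘(ℝ, EuclideanSpace ℝ (Fin 2)) 𝓘(ℝ, W) ∞ (F ∘ φ.symm) (φ p) := by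
      refine ContMDiffAt.comp_of_eq (I' := 𝓡 2) hF ?_ (by simp [φ])
      exact (contMDiffOn_extChartAt_symm p).contMDiffAt (extChartAt_target_mem_nhds p)
    exact h1.contDiffAt
  have hd : DifferentiableAt ℝ (fderiv ℝ (F ∘ φ.symm)) (φ p) :=
    ((hFφ.fderiv_right (m := 1) (by norm_num; exact WithTop.coe_le_coe.2 (le_top (a := (2 : ℕ∞))))).differentiableAt one_ne_zero)
  have hFev : ∀ᶠ q in 𝓝 p, MDifferentiableAt (𝓡 2) 𝓘(ℝ, W) F q := by
    obtain ⟨u, hu, hFu⟩ := (contMDiffAt_iff_contMDiffOn_nhds (n := 1) (by simp)).1 (hF.of_le (by simp))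
    filter_upwards [eventually_mem_nhds_iff.2 hu] with q hq
    exact (hFu.contMDiffAt hq).mdifferentiableAt one_ne_zero
  have key : ∀ y z, derivAlong (fun q => derivAlong F q
      (FiberBundle.extend (EuclideanSpace ℝ (Fin 2)) y q)) p z =
      fderiv ℝ (fderiv ℝ (F ∘ φ.symm)) (φ p) (w z) (w y) := by
    intro y z
    have h1 : (fun q => derivAlong F q (FiberBundle.extend (EuclideanSpace ℝ (Fin 2)) y q))
        =ᶠ[𝓝 p] fun q => fderiv ℝ (F ∘ φ.symm) (φ q) (w y) := by
      filter_upwards [hFev, (chartAt (EuclideanSpace ℝ (Fin 2)) p).open_source.mem_nhds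
        (mem_chart_source _ p)] with q hq hq'
      exact derivAlong_extend hq' hq y
    have hG : MDifferentiableAt (𝓡 2) 𝓘(ℝ, W) (fun q => fderiv ℝ (F ∘ φ.symm) (φ q) (w y)) p := by
      have := hd.clm_apply (differentiableAt_const (w y))
      exact this.mdifferentiableAt.comp p (mdifferentiableAt_extChartAt (mem_chart_source _ p))
    rw [derivAlong_congr h1]
    have h2 := derivAlong_extend (mem_chart_source _ p) hG z
    rw [FiberBundle.extend_apply_self] at h2
    rw [h2]
    have h3 : (fun q => fderiv ℝ (F ∘ φ.symm) (φ q) (w y)) ∘ (extChartAt (𝓡 2) p).symm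
        =ᶠ[𝓝 (φ p)] fun u => fderiv ℝ (F ∘ φ.symm) u (w y) := by
      filter_upwards [extChartAt_target_mem_nhds p] with u hu
      simp only [Function.comp]
      rw [hφ, (extChartAt (𝓡 2) p).right_inv hu]
    rw [h3.fderiv_eq, fderiv_clm_apply hd (differentiableAt_const _)]
    simp [w]
  rw [key, key]
  exact hFφ.isSymmSndFDerivAt (by simp; exact WithTop.coe_le_coe.2 (le_top (a := (2 : ℕ∞)))) _ _

end Calculus
end AffineSurface

/-! ### Orthonormal expansion, and projection along a transversal plane -/

namespace AffineSurface

namespace IsBlaschkeData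

variable {φ : A4 → ℝ} {β : A4 →L[ℝ] A4 →L[ℝ] ℝ} {θ₀ : A4 →L[ℝ] ℝ} {δ : ℝ} {η₀ : A4}

/-- The volume condition makes the squared determinant of a, b, e and the affine normal equal to 1,
so these vectors form a basis. The form β reads off the first three coefficients and the conormal
the last. -/
theorem eq_sum (h : IsBlaschkeData φ β θ₀ δ η₀) {x : A4} (hx : φ x = 0) {a b e : A4}
    (ha : conormal β θ₀ x a = 0) (hb : conormal β θ₀ x b = 0) (he : conormal β θ₀ x e = 0)
    (haa : β a a = 1) (hbb : β b b = 1) (hee : β e e = 1) (hab : β a b = 0) (hae : β a e = 0)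
    (hbe : β b e = 0) (w : A4) :
    w = β w a • a + β w b • b + β w e • e + conormal β θ₀ x w • affineNormal δ η₀ x := by
  set η := affineNormal δ η₀ x
  have hdet : bracket a b e η ^ 2 = 1 := by
    have := h.gram x hx ![a, b, e] (by intro i; fin_cases i <;> simpa)
    rw [Matrix.det_fin_three] at this
    simpa [haa, hbb, hee, hab, hae, hbe, h.symm b a, h.symm e a, h.symm e b] using this.symm
  have hunit : IsUnit (Matrix.of ![a, b, e, η]).det := by
    rw [isUnit_iff_ne_zero]
    intro h0
    rw [bracket, h0] at hdet
    norm_num at hdet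
  obtain ⟨c, hc⟩ : ∃ c : A4, w = c 0 • a + c 1 • b + c 2 • e + c 3 • η := by
    refine ⟨Matrix.vecMul w (Matrix.of ![a, b, e, η])⁻¹, ?_⟩
    have h1 : Matrix.vecMul (Matrix.vecMul w (Matrix.of ![a, b, e, η])⁻¹) (Matrix.of ![a, b, e, η])
        = w := by
      rw [Matrix.vecMul_vecMul, Matrix.nonsing_inv_mul _ hunit, Matrix.vecMul_one]
    conv_lhs => rw [← h1]
    ext i
    simp [Matrix.vecMul, dotProduct, Fin.sum_univ_four]
  have hη : ∀ y, conormal β θ₀ x y = 0 → β η y = 0 := h.orthogonal x hx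
  have hθη : conormal β θ₀ x η = 1 := h.conormal_normal x hx
  have h0 : β w a = c 0 := by
    rw [hc]; simp [haa, hη a ha, h.symm b a, hab, h.symm e a, hae]
  have h1 : β w b = c 1 := by
    rw [hc]; simp [hbb, hη b hb, hab, h.symm e b, hbe]
  have h2 : β w e = c 2 := by
    rw [hc]; simp [hee, hη e he, hae, hbe]
  have h3 : conormal β θ₀ x w = c 3 := by
    rw [hc]; simp [ha, hb, he, hθη]
  rw [h0, h1, h2, h3]
  exact hc

end IsBlaschkeData

section Surface

variable {M : Type*} [TopologicalSpace M] [ChartedSpace (EuclideanSpace ℝ (Fin 2)) M]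

theorem deriv4_eq_derivAlong (F : M → A4) (p : M) (x : TangentSpace (𝓡 2) p) :
    deriv4 F p x = derivAlong F p x := rfl

theorem deriv1_eq_derivAlong (F : M → ℝ) (p : M) (x : TangentSpace (𝓡 2) p) :
    deriv1 F p x = derivAlong F p x := rfl

theorem deriv4_add (F : M → A4) (p : M) (x y : TangentSpace (𝓡 2) p) :
    deriv4 F p (x + y) = deriv4 F p x + deriv4 F p y :=
  map_add (mfderiv (𝓡 2) 𝓘(ℝ, A4) F p) x y

theorem deriv4_sub (F : M → A4) (p : M) (x y : TangentSpace (𝓡 2) p) :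
    deriv4 F p (x - y) = deriv4 F p x - deriv4 F p y :=
  map_sub (mfderiv (𝓡 2) 𝓘(ℝ, A4) F p) x y

theorem deriv4_smul (F : M → A4) (p : M) (c : ℝ) (x : TangentSpace (𝓡 2) p) :
    deriv4 F p (c • x) = c • deriv4 F p x :=
  map_smul (mfderiv (𝓡 2) 𝓘(ℝ, A4) F p) c x

theorem deriv4_zero (F : M → A4) (p : M) : deriv4 F p 0 = 0 :=
  map_zero (mfderiv (𝓡 2) 𝓘(ℝ, A4) F p)

theorem mem_tangentPlane {f : M → A4} {p : M} {w : A4} :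
    w ∈ tangentPlane f p ↔ ∃ y, deriv4 f p y = w := Iff.rfl

theorem IsImmersedSurface.deriv4_injective {f : M → A4} (hf : IsImmersedSurface f) (p : M) :
    Function.Injective (deriv4 f p) := hf.injective p

theorem IsImmersedSurface.deriv4_eq_zero {f : M → A4} (hf : IsImmersedSurface f) {p : M}
    {y : TangentSpace (𝓡 2) p} : deriv4 f p y = 0 ↔ y = 0 := by
  rw [← deriv4_zero f p, (hf.deriv4_injective p).eq_iff]

theorem exists_eq_smul_add_smul {x₁ x₂ : EuclideanSpace ℝ (Fin 2)}
    (h : ∀ a b : ℝ, a • x₁ + b • x₂ = 0 → a = 0 ∧ b = 0) (y : EuclideanSpace ℝ (Fin 2)) :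
    ∃ a b : ℝ, y = a • x₁ + b • x₂ := by
  have hspan := (LinearIndependent.pair_iff.2 h).span_eq_top_of_card_eq_finrank (by simp)
  have hy : y ∈ Submodule.span ℝ (Set.range ![x₁, x₂]) := by
    rw [hspan]
    trivial
  rw [Matrix.range_cons, Matrix.range_cons, Matrix.range_empty, Set.union_empty,
    Set.singleton_union, Submodule.mem_span_pair] at hy
  obtain ⟨a, b, hab⟩ := hy
  exact ⟨a, b, hab.symm⟩

section TangentialPart

variable {f : M → A4} {σ : M → Submodule ℝ A4} {p : M}

theorem tangentialPart_eq (hf : IsImmersedSurface f) (hσ : Disjoint (tangentPlane f p) (σ p))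
    {w : A4} {v : TangentSpace (𝓡 2) p} (h : w - deriv4 f p v ∈ σ p) :
    tangentialPart f σ p w = v := by
  have hex : ∃ v, w - deriv4 f p v ∈ σ p := ⟨v, h⟩
  rw [tangentialPart, dif_pos hex]
  have h1 := (σ p).sub_mem h hex.choose_spec
  rw [sub_sub_sub_cancel_left, ← deriv4_sub] at h1
  have h2 := Submodule.disjoint_def.1 hσ _ (mem_tangentPlane.2 ⟨_, rfl⟩) h1
  rw [hf.deriv4_eq_zero, sub_eq_zero] at h2
  exact h2

theorem sub_tangentialPart_mem (hσ : IsCompl (tangentPlane f p) (σ p)) (w : A4) :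
    w - deriv4 f p (tangentialPart f σ p w) ∈ σ p := by
  obtain ⟨u, s, hu, hs, hus⟩ := Submodule.codisjoint_iff_exists_add_eq.1 hσ.codisjoint w
  obtain ⟨v, rfl⟩ := mem_tangentPlane.1 hu
  have hex : ∃ v, w - deriv4 f p v ∈ σ p := ⟨v, by rwa [← hus, add_sub_cancel_left]⟩
  rw [tangentialPart, dif_pos hex]
  exact hex.choose_spec

theorem tangentialPart_add (hf : IsImmersedSurface f) (hσ : IsCompl (tangentPlane f p) (σ p))
    (w w' : A4) :
    tangentialPart f σ p (w + w') = tangentialPart f σ p w + tangentialPart f σ p w' := by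
  refine tangentialPart_eq hf hσ.disjoint ?_
  rw [deriv4_add, add_sub_add_comm]
  exact (σ p).add_mem (sub_tangentialPart_mem hσ w) (sub_tangentialPart_mem hσ w')

theorem tangentialPart_smul (hf : IsImmersedSurface f) (hσ : IsCompl (tangentPlane f p) (σ p))
    (c : ℝ) (w : A4) :
    tangentialPart f σ p (c • w) = c • tangentialPart f σ p w := by
  refine tangentialPart_eq hf hσ.disjoint ?_
  rw [deriv4_smul, ← smul_sub]
  exact (σ p).smul_mem c (sub_tangentialPart_mem hσ w)

theorem tangentialPart_deriv4 (hf : IsImmersedSurface f) (hσ : IsCompl (tangentPlane f p) (σ p))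
    (v : TangentSpace (𝓡 2) p) :
    tangentialPart f σ p (deriv4 f p v) = v :=
  tangentialPart_eq hf hσ.disjoint (by simp)

theorem tangentialPart_eq_zero_iff (hf : IsImmersedSurface f) (hσ : IsCompl (tangentPlane f p) (σ p))
    {w : A4} : tangentialPart f σ p w = 0 ↔ w ∈ σ p := by
  constructor
  · intro h
    simpa [h, deriv4_zero] using sub_tangentialPart_mem hσ w
  · intro h
    exact tangentialPart_eq hf hσ.disjoint (by simpa [deriv4_zero])

end TangentialPart

end Surface
end AffineSurface

/-! ### Adapted orthonormal frames -/

namespace AffineSurface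

variable {M : Type*} [TopologicalSpace M] [ChartedSpace (EuclideanSpace ℝ (Fin 2)) M]
  {φ : A4 → ℝ} {β : A4 →L[ℝ] A4 →L[ℝ] ℝ} {θ₀ : A4 →L[ℝ] ℝ} {δ : ℝ} {η₀ : A4} {f : M → A4}

theorem contMDiffOn_bilin (β : A4 →L[ℝ] A4 →L[ℝ] ℝ) {V : Set M} {F G : M → A4} (hF : SmoothOn V F)
    (hG : SmoothOn V G) : ContMDiffOn (𝓡 2) 𝓘(ℝ, ℝ) ∞ (fun q => β (F q) (G q)) V :=
  ContMDiffOn.clm_apply (β.contMDiff.comp_contMDiffOn hF) hG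

theorem smoothOn_affineNormal (hf : IsImmersedSurface f) (δ : ℝ) (η₀ : A4) (V : Set M) :
    SmoothOn V (fun q => affineNormal δ η₀ (f q)) := by
  have : ContDiff ℝ ∞ (affineNormal δ η₀) := by
    unfold affineNormal
    fun_prop
  exact this.comp_contMDiff hf.smooth |>.contMDiffOn

theorem SmoothOn.smul {V : Set M} {a : M → ℝ} {F : M → A4}
    (ha : ContMDiffOn (𝓡 2) 𝓘(ℝ, ℝ) ∞ a V) (hF : SmoothOn V F) : SmoothOn V (fun q => a q • F q) :=
  ContMDiffOn.smul ha hF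

theorem contMDiffOn_inv_sqrt {V : Set M} {a : M → ℝ}
    (ha : ContMDiffOn (𝓡 2) 𝓘(ℝ, ℝ) ∞ a V) (hpos : ∀ q ∈ V, 0 < a q) :
    ContMDiffOn (𝓡 2) 𝓘(ℝ, ℝ) ∞ (fun q => (√(a q))⁻¹) V := by
  intro q hq
  have h1 : ContDiffAt ℝ ∞ (fun t : ℝ => (√t)⁻¹) (a q) :=
    (Real.contDiffAt_sqrt (hpos q hq).ne').inv (Real.sqrt_ne_zero'.2 (hpos q hq))
  exact h1.comp_contMDiffWithinAt (ha q hq)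

theorem isOpen_inter_pos {V : Set M} (hV : IsOpen V) {a : M → ℝ}
    (ha : ContMDiffOn (𝓡 2) 𝓘(ℝ, ℝ) ∞ a V) : IsOpen (V ∩ {q | 0 < a q}) :=
  ha.continuousOn.isOpen_inter_preimage hV isOpen_Ioi

theorem inv_sqrt_smul_self (β : A4 →L[ℝ] A4 →L[ℝ] ℝ) {w : A4} (hw : 0 < β w w) :
    β ((√(β w w))⁻¹ • w) ((√(β w w))⁻¹ • w) = 1 := by
  have := Real.mul_self_sqrt hw.le
  have h0 := (Real.sqrt_pos.2 hw).ne'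
  simp only [map_smul, smul_apply, smul_eq_mul]
  field_simp
  linarith

/-- The function φ ∘ f vanishes identically, so its derivative does too. -/
theorem conormal_deriv4 (h : IsBlaschkeData φ β θ₀ δ η₀) (hf : IsImmersedSurface f)
    (hfφ : ∀ p, φ (f p) = 0) (p : M) (y : TangentSpace (𝓡 2) p) :
    conormal β θ₀ (f p) (deriv4 f p y) = 0 := by
  rw [← h.ker_fderiv _ (hfφ p)]
  have h1 := (h.differentiable (f p)).hasFDerivAt.hasMFDerivAt.comp p
    ((hf.smooth p).mdifferentiableAt (by simp)).hasMFDerivAt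
  have h2 := derivAlong_eq_of_hasMFDerivAt h1 y
  rw [show φ ∘ f = fun _ => 0 from funext hfφ, derivAlong_const] at h2
  exact h2.symm

theorem contMDiffOn_conormal (hf : IsImmersedSurface f) {V : Set M} {F : M → A4}
    (hF : SmoothOn V F) :
    ContMDiffOn (𝓡 2) 𝓘(ℝ, ℝ) ∞ (fun q => conormal β θ₀ (f q) (F q)) V :=
  (θ₀.contMDiff.comp_contMDiffOn hF).sub (contMDiffOn_bilin β hf.smooth.contMDiffOn hF)

theorem deriv4_pos (h : IsBlaschkeData φ β θ₀ δ η₀) (hf : IsImmersedSurface f)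
    (hfφ : ∀ p, φ (f p) = 0) {p : M} {y : TangentSpace (𝓡 2) p} (hy : y ≠ 0) :
    0 < β (deriv4 f p y) (deriv4 f p y) :=
  h.pos _ (hfφ p) _ (conormal_deriv4 h hf hfφ p y) (by rwa [Ne, hf.deriv4_eq_zero])

theorem exists_frame_euclideanSpace : ∃ v₁ v₂ : EuclideanSpace ℝ (Fin 2), ∀ a b : ℝ,
    a • v₁ + b • v₂ = 0 → a = 0 ∧ b = 0 := by
  refine ⟨EuclideanSpace.single 0 1, EuclideanSpace.single 1 1, fun a b hab => ?_⟩
  have h0 := congrArg (fun v => v 0) hab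
  have h1 := congrArg (fun v => v 1) hab
  exact ⟨by simpa using h0, by simpa using h1⟩

variable [IsManifold (𝓡 2) ∞ M]

/-- A smooth frame `X₁, X₂` of `M` and a smooth normal field `e`, tangent to the hyperquadric, which
are orthonormal with respect to `β`. -/
structure IsAdaptedFrameOn (f : M → A4) (β : A4 →L[ℝ] A4 →L[ℝ] ℝ) (θ₀ : A4 →L[ℝ] ℝ) (V : Set M)
    (X₁ X₂ : Field M) (e : M → A4) : Prop where
  smooth₁ : SmoothFieldOn V X₁
  smooth₂ : SmoothFieldOn V X₂
  smooth_normal : SmoothOn V e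
  unit₁ : ∀ q ∈ V, β (deriv4 f q (X₁ q)) (deriv4 f q (X₁ q)) = 1
  unit₂ : ∀ q ∈ V, β (deriv4 f q (X₂ q)) (deriv4 f q (X₂ q)) = 1
  orthogonal : ∀ q ∈ V, β (deriv4 f q (X₁ q)) (deriv4 f q (X₂ q)) = 0
  unit_normal : ∀ q ∈ V, β (e q) (e q) = 1
  normal₁ : ∀ q ∈ V, β (deriv4 f q (X₁ q)) (e q) = 0
  normal₂ : ∀ q ∈ V, β (deriv4 f q (X₂ q)) (e q) = 0
  conormal_normal : ∀ q ∈ V, conormal β θ₀ (f q) (e q) = 0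

theorem smoothOn_deriv4 (hf : IsImmersedSurface f) {V : Set M} (hV : IsOpen V) {X : Field M}
    (hX : SmoothFieldOn V X) : SmoothOn V (fun q => deriv4 f q (X q)) :=
  contMDiffOn_derivAlong hV hf.smooth.contMDiffOn hX

/-- Gram–Schmidt for β: first on a local frame of M, then on a constant vector projected into the
tangent hyperplane of the quadric. The domain shrinks at each stage to where the square to be
normalised is positive. -/
theorem exists_adaptedFrameOn (h : IsBlaschkeData φ β θ₀ δ η₀) (hf : IsImmersedSurface f)
    (hfφ : ∀ p, φ (f p) = 0) {U : Set M} (hU : IsOpen U) {p : M} (hp : p ∈ U) :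
    ∃ (V : Set M) (X₁ X₂ : Field M) (e : M → A4), IsOpen V ∧ p ∈ V ∧ V ⊆ U ∧
      IsAdaptedFrameOn f β θ₀ V X₁ X₂ e := by
  have hθ := conormal_deriv4 h hf hfφ
  have hext : ∀ v : TangentSpace (𝓡 2) p, ∃ V, IsOpen V ∧ p ∈ V ∧
      SmoothFieldOn V (FiberBundle.extend (EuclideanSpace ℝ (Fin 2)) v) := by
    intro v
    obtain ⟨s, hs, hsv⟩ := FiberBundle.exists_contMDiffOn_extend (k := ∞) (𝓡 2)
      (EuclideanSpace ℝ (Fin 2)) v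
    obtain ⟨V, hVs, hV, hpV⟩ := mem_nhds_iff.1 hs
    exact ⟨V, hV, hpV, hsv.mono hVs⟩
  obtain ⟨v₁, v₂, hv⟩ : ∃ v₁ v₂ : TangentSpace (𝓡 2) p, ∀ a b : ℝ,
      a • v₁ + b • v₂ = 0 → a = 0 ∧ b = 0 := exists_frame_euclideanSpace
  obtain ⟨V₁, hV₁, hp₁, hs₁⟩ := hext v₁
  obtain ⟨V₂, hV₂, hp₂, hs₂⟩ := hext v₂
  set Y₁ : Field M := FiberBundle.extend (EuclideanSpace ℝ (Fin 2)) v₁ with hY₁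
  set Y₂ : Field M := FiberBundle.extend (EuclideanSpace ℝ (Fin 2)) v₂ with hY₂
  set A : Set M := U ∩ (V₁ ∩ V₂)
  have hA : IsOpen A := hU.inter (hV₁.inter hV₂)
  replace hs₁ : SmoothFieldOn A Y₁ := hs₁.mono fun q hq => hq.2.1
  replace hs₂ : SmoothFieldOn A Y₂ := hs₂.mono fun q hq => hq.2.2
  have ha₁ := contMDiffOn_bilin β (smoothOn_deriv4 hf hA hs₁) (smoothOn_deriv4 hf hA hs₁)
  set a₁ : M → ℝ := fun q => β (deriv4 f q (Y₁ q)) (deriv4 f q (Y₁ q)) with ha₁_def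
  set B := A ∩ {q | 0 < a₁ q}
  have hB : IsOpen B := isOpen_inter_pos hA ha₁
  have hpB : p ∈ B := by
    refine ⟨⟨hp, hp₁, hp₂⟩, deriv4_pos h hf hfφ ?_⟩
    rw [hY₁, FiberBundle.extend_apply_self]
    rintro rfl
    simpa using hv 1 0 (by simp)
  set X₁ : Field M := fun q => (√(a₁ q))⁻¹ • Y₁ q with hX₁
  have hsX₁ : SmoothFieldOn B X₁ :=
    ContMDiffOn.smul_section (contMDiffOn_inv_sqrt (ha₁.mono Set.inter_subset_left) fun q hq => hq.2)
      (hs₁.mono Set.inter_subset_left)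
  have hu₁ : ∀ q ∈ B, β (deriv4 f q (X₁ q)) (deriv4 f q (X₁ q)) = 1 := by
    intro q hq
    rw [hX₁, deriv4_smul]
    exact inv_sqrt_smul_self β hq.2
  set b : M → ℝ := fun q => β (deriv4 f q (X₁ q)) (deriv4 f q (Y₂ q))
  have hb : ContMDiffOn (𝓡 2) 𝓘(ℝ, ℝ) ∞ b B := contMDiffOn_bilin β (smoothOn_deriv4 hf hB hsX₁)
    (smoothOn_deriv4 hf hB (hs₂.mono Set.inter_subset_left))
  set Z₂ : Field M := fun q => Y₂ q - b q • X₁ q with hZ₂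
  have hsZ₂ : SmoothFieldOn B Z₂ :=
    ContMDiffOn.sub_section (hs₂.mono Set.inter_subset_left) (ContMDiffOn.smul_section hb hsX₁)
  have hXZ : ∀ q ∈ B, β (deriv4 f q (X₁ q)) (deriv4 f q (Z₂ q)) = 0 := by
    intro q hq
    have e : deriv4 f q (Z₂ q) = deriv4 f q (Y₂ q) - b q • deriv4 f q (X₁ q) :=
      (deriv4_sub f q _ _).trans (by rw [deriv4_smul])
    rw [e, map_sub, map_smul, hu₁ q hq]
    simp [b]
  have ha₂ := contMDiffOn_bilin β (smoothOn_deriv4 hf hB hsZ₂) (smoothOn_deriv4 hf hB hsZ₂)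
  set a₂ : M → ℝ := fun q => β (deriv4 f q (Z₂ q)) (deriv4 f q (Z₂ q))
  set C := B ∩ {q | 0 < a₂ q}
  have hC : IsOpen C := isOpen_inter_pos hB ha₂
  have hpC : p ∈ C := by
    refine ⟨hpB, deriv4_pos h hf hfφ ?_⟩
    intro h0
    have h1 : (-(b p * (√(a₁ p))⁻¹)) • v₁ + (1 : ℝ) • v₂ = 0 := by
      simp only [hZ₂, hX₁, hY₁, hY₂, FiberBundle.extend_apply_self] at h0
      rw [← h0]
      module
    simpa using (hv _ _ h1).2
  set X₂ : Field M := fun q => (√(a₂ q))⁻¹ • Z₂ q with hX₂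
  have hsX₂ : SmoothFieldOn C X₂ :=
    ContMDiffOn.smul_section (contMDiffOn_inv_sqrt (ha₂.mono Set.inter_subset_left) fun q hq => hq.2)
      (hsZ₂.mono Set.inter_subset_left)
  have hu₂ : ∀ q ∈ C, β (deriv4 f q (X₂ q)) (deriv4 f q (X₂ q)) = 1 := by
    intro q hq
    rw [hX₂, deriv4_smul]
    exact inv_sqrt_smul_self β hq.2
  have h12 : ∀ q ∈ C, β (deriv4 f q (X₁ q)) (deriv4 f q (X₂ q)) = 0 := by
    intro q hq
    have e : deriv4 f q (X₂ q) = (√(a₂ q))⁻¹ • deriv4 f q (Z₂ q) := deriv4_smul f q _ _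
    rw [e, map_smul, hXZ q hq.1, smul_zero]
  replace hsX₁ : SmoothFieldOn C X₁ := hsX₁.mono Set.inter_subset_left
  replace hu₁ : ∀ q ∈ C, β (deriv4 f q (X₁ q)) (deriv4 f q (X₁ q)) = 1 := fun q hq => hu₁ q hq.1
  -- Three vectors cannot span a space of dimension four. This w keeps the field n below nonzero at
  -- p, hence of positive square there.
  obtain ⟨w, hw⟩ : ∃ w : A4, w ∉ Submodule.span ℝ
      (Set.range ![deriv4 f p (X₁ p), deriv4 f p (X₂ p), affineNormal δ η₀ (f p)]) := by
    by_contra! hall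
    have h1 := finrank_range_le_card (R := ℝ)
      ![deriv4 f p (X₁ p), deriv4 f p (X₂ p), affineNormal δ η₀ (f p)]
    rw [Set.finrank, Submodule.eq_top_iff'.2 hall, finrank_top] at h1
    simp at h1
  set n : M → A4 := fun q => w - conormal β θ₀ (f q) w • affineNormal δ η₀ (f q) -
    β w (deriv4 f q (X₁ q)) • deriv4 f q (X₁ q) - β w (deriv4 f q (X₂ q)) • deriv4 f q (X₂ q) with hn_def
  have hsw : SmoothOn C (fun _ : M => w) := contMDiffOn_const
  have hsd₁ := smoothOn_deriv4 hf hC hsX₁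
  have hsd₂ := smoothOn_deriv4 hf hC hsX₂
  have hsn : SmoothOn C n :=
    (((contMDiffOn_const.sub (SmoothOn.smul (contMDiffOn_conormal hf hsw)
      (smoothOn_affineNormal hf δ η₀ C))).sub (SmoothOn.smul (contMDiffOn_bilin β hsw hsd₁) hsd₁)).sub
      (SmoothOn.smul (contMDiffOn_bilin β hsw hsd₂) hsd₂))
  have ha₃ := contMDiffOn_bilin β hsn hsn
  have hnθ : ∀ q, conormal β θ₀ (f q) (n q) = 0 := by
    intro q
    simp [hn_def, hθ, h.conormal_normal _ (hfφ q)]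
  have hη : ∀ q y, β (deriv4 f q y) (affineNormal δ η₀ (f q)) = 0 := by
    intro q y
    rw [h.symm]
    exact h.orthogonal _ (hfφ q) _ (hθ q y)
  have hn₁ : ∀ q ∈ C, β (deriv4 f q (X₁ q)) (n q) = 0 := by
    intro q hq
    simp [hn_def, hη, hu₁ q hq, h12 q hq, h.symm w]
  have hn₂ : ∀ q ∈ C, β (deriv4 f q (X₂ q)) (n q) = 0 := by
    intro q hq
    simp [hn_def, hη, hu₂ q hq, h12 q hq, h.symm w, h.symm (deriv4 f q (X₂ q)) (deriv4 f q (X₁ q))]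
  refine ⟨C ∩ {q | 0 < β (n q) (n q)}, X₁, X₂, fun q => (√(β (n q) (n q)))⁻¹ • n q,
    isOpen_inter_pos hC ha₃, ⟨hpC, ?_⟩, fun q hq => hq.1.1.1.1, ?_⟩
  · refine h.pos _ (hfφ p) _ (hnθ p) fun h0 => hw ?_
    have hmem : ∀ i, ![deriv4 f p (X₁ p), deriv4 f p (X₂ p), affineNormal δ η₀ (f p)] i ∈
        Submodule.span ℝ (Set.range ![deriv4 f p (X₁ p), deriv4 f p (X₂ p), affineNormal δ η₀ (f p)]) :=
      fun i => Submodule.subset_span ⟨i, rfl⟩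
    have h1 : w = conormal β θ₀ (f p) w • affineNormal δ η₀ (f p) +
        β w (deriv4 f p (X₁ p)) • deriv4 f p (X₁ p) + β w (deriv4 f p (X₂ p)) • deriv4 f p (X₂ p) := by
      rw [← sub_eq_zero, ← h0]
      simp only [hn_def]
      abel
    rw [h1]
    exact add_mem (add_mem (Submodule.smul_mem _ _ (hmem 2)) (Submodule.smul_mem _ _ (hmem 0)))
      (Submodule.smul_mem _ _ (hmem 1))
  · constructor
    · exact hsX₁.mono Set.inter_subset_left
    · exact hsX₂.mono Set.inter_subset_left
    · exact SmoothOn.smul (contMDiffOn_inv_sqrt (ha₃.mono Set.inter_subset_left) fun q hq => hq.2)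
        (hsn.mono Set.inter_subset_left)
    · exact fun q hq => hu₁ q hq.1
    · exact fun q hq => hu₂ q hq.1
    · exact fun q hq => h12 q hq.1
    · exact fun q hq => inv_sqrt_smul_self β hq.2
    · intro q hq
      simp [hn₁ q hq.1]
    · intro q hq
      simp [hn₂ q hq.1]
    · intro q hq
      simp [hnθ q]

end AffineSurface

/-! ### Structure equations of the surface in the hyperquadric -/

namespace AffineSurface

variable {M : Type*} [TopologicalSpace M] [ChartedSpace (EuclideanSpace ℝ (Fin 2)) M]
  {φ : A4 → ℝ} {β : A4 →L[ℝ] A4 →L[ℝ] ℝ} {θ₀ : A4 →L[ℝ] ℝ} {δ : ℝ} {η₀ : A4} {f : M → A4}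

theorem SmoothOn.mdifferentiableAt {V : Set M} (hV : IsOpen V) {F : M → A4} (hF : SmoothOn V F)
    {q : M} (hq : q ∈ V) : MDifferentiableAt (𝓡 2) 𝓘(ℝ, A4) F q :=
  (hF.contMDiffAt (hV.mem_nhds hq)).mdifferentiableAt (by simp)

theorem exists_tangent_eq_of_orthonormal (hβ : ∀ y z, β y z = β z y) {p : M}
    {x₁ x₂ : TangentSpace (𝓡 2) p} (h₁ : β (deriv4 f p x₁) (deriv4 f p x₁) = 1)
    (h₂ : β (deriv4 f p x₂) (deriv4 f p x₂) = 1) (h₁₂ : β (deriv4 f p x₁) (deriv4 f p x₂) = 0)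
    (y : TangentSpace (𝓡 2) p) : ∃ a b : ℝ, y = a • x₁ + b • x₂ := by
  refine exists_eq_smul_add_smul (fun a b hab => ?_) y
  have h0 : a • deriv4 f p x₁ + b • deriv4 f p x₂ = 0 := by
    rw [← deriv4_smul, ← deriv4_smul, ← deriv4_add]
    exact (congrArg (deriv4 f p) hab).trans (deriv4_zero f p)
  constructor
  · simpa [h₁, h₁₂, hβ (deriv4 f p x₂) (deriv4 f p x₁)] using
      congrArg (fun w => β w (deriv4 f p x₁)) h0
  · simpa [h₂, h₁₂] using congrArg (fun w => β w (deriv4 f p x₂)) h0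

theorem derivAlong_conormal (hf : IsImmersedSurface f) {F : M → A4} {q : M}
    (hF : MDifferentiableAt (𝓡 2) 𝓘(ℝ, A4) F q) (x : TangentSpace (𝓡 2) q) :
    derivAlong (fun r => conormal β θ₀ (f r) (F r)) q x =
      conormal β θ₀ (f q) (derivAlong F q x) - β (deriv4 f q x) (F q) := by
  have hfq : MDifferentiableAt (𝓡 2) 𝓘(ℝ, A4) f q := (hf.smooth q).mdifferentiableAt (by simp)
  have h1 := derivAlong_sub (F := fun r => θ₀ (F r)) (G := fun r => β (f r) (F r))
    (θ₀.mdifferentiableAt.comp q hF) ((β.mdifferentiableAt.comp q hfq).clm_apply hF) x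
  rw [derivAlong_clm θ₀ hF, derivAlong_bilinear β hfq hF] at h1
  refine h1.trans ?_
  simp only [conormal, sub_apply, deriv4_eq_derivAlong]
  ring

theorem derivAlong_affineNormal (hf : IsImmersedSurface f) (q : M) (x : TangentSpace (𝓡 2) q) :
    derivAlong (fun r => affineNormal δ η₀ (f r)) q x = δ • deriv4 f q x := by
  have hfq : MDifferentiableAt (𝓡 2) 𝓘(ℝ, A4) f q := (hf.smooth q).mdifferentiableAt (by simp)
  have h1 := derivAlong_add (F := fun r => (δ • ContinuousLinearMap.id ℝ A4) (f r))
    (G := fun _ => η₀) ((δ • ContinuousLinearMap.id ℝ A4).mdifferentiableAt.comp q hfq)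
    mdifferentiableAt_const x
  rw [derivAlong_clm _ hfq, derivAlong_const, add_zero] at h1
  exact h1

variable [IsManifold (𝓡 2) ∞ M]

/-- As β is constant, the product rule for β(Y, Z) leaves only the σ-components of D_X Y and D_X Z,
paired with the other field. -/
theorem nablaMetric_eq (hf : IsImmersedSurface f) {σ : M → Submodule ℝ A4} {g : FormField M}
    {V : Set M} (hV : IsOpen V) (hg : ∀ q ∈ V, ∀ y z, g q y z = β (deriv4 f q y) (deriv4 f q z))
    {X Y Z : Field M} (hY : SmoothFieldOn V Y) (hZ : SmoothFieldOn V Z) {p : M} (hp : p ∈ V) :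
    nablaMetric f σ g X Y Z p =
      β (flatD f p (X p) Y - deriv4 f p (inducedConnection f σ X Y p)) (deriv4 f p (Z p)) +
      β (deriv4 f p (Y p)) (flatD f p (X p) Z - deriv4 f p (inducedConnection f σ X Z p)) := by
  have h1 : (fun q => g q (Y q) (Z q)) =ᶠ[𝓝 p] fun q => β (deriv4 f q (Y q)) (deriv4 f q (Z q)) := by
    filter_upwards [hV.mem_nhds hp] with q hq using hg q hq _ _
  rw [nablaMetric, deriv1_eq_derivAlong, derivAlong_congr h1, derivAlong_bilinear β
    ((smoothOn_deriv4 hf hV hY).mdifferentiableAt hV hp)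
    ((smoothOn_deriv4 hf hV hZ).mdifferentiableAt hV hp), hg p hp, hg p hp]
  simp only [map_sub, sub_apply, flatD, deriv4_eq_derivAlong]
  ring

/-- The second fundamental form of the surface in the hyperquadric with respect to the field `e`. -/
def secondForm (β : A4 →L[ℝ] A4 →L[ℝ] ℝ) (f e : M → A4) (q : M) (x y : TangentSpace (𝓡 2) q) : ℝ :=
  -β (deriv4 f q y) (deriv4 e q x)

namespace IsAdaptedFrameOn

variable {V : Set M} {X₁ X₂ : Field M} {e : M → A4}

theorem eq_sum (F : IsAdaptedFrameOn f β θ₀ V X₁ X₂ e) (h : IsBlaschkeData φ β θ₀ δ η₀)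
    (hf : IsImmersedSurface f) (hfφ : ∀ p, φ (f p) = 0) {q : M} (hq : q ∈ V) (w : A4) :
    w = β w (deriv4 f q (X₁ q)) • deriv4 f q (X₁ q) + β w (deriv4 f q (X₂ q)) • deriv4 f q (X₂ q) +
      β w (e q) • e q + conormal β θ₀ (f q) w • affineNormal δ η₀ (f q) :=
  h.eq_sum (hfφ q) (conormal_deriv4 h hf hfφ q _) (conormal_deriv4 h hf hfφ q _)
    (F.conormal_normal q hq) (F.unit₁ q hq) (F.unit₂ q hq) (F.unit_normal q hq) (F.orthogonal q hq)
    (F.normal₁ q hq) (F.normal₂ q hq) w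

theorem exists_tangent_eq (F : IsAdaptedFrameOn f β θ₀ V X₁ X₂ e)
    (h : IsBlaschkeData φ β θ₀ δ η₀) {q : M} (hq : q ∈ V) (y : TangentSpace (𝓡 2) q) :
    ∃ a b : ℝ, y = a • X₁ q + b • X₂ q :=
  exists_tangent_eq_of_orthonormal h.symm (F.unit₁ q hq) (F.unit₂ q hq) (F.orthogonal q hq) y

theorem normal (F : IsAdaptedFrameOn f β θ₀ V X₁ X₂ e) (h : IsBlaschkeData φ β θ₀ δ η₀) {q : M}
    (hq : q ∈ V) (y : TangentSpace (𝓡 2) q) : β (deriv4 f q y) (e q) = 0 := by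
  obtain ⟨a, b, rfl⟩ := F.exists_tangent_eq h hq y
  rw [deriv4_add, deriv4_smul, deriv4_smul]
  simp [F.normal₁ q hq, F.normal₂ q hq]

/-- Differentiate the identity conormal(Y) = 0; the conormal has derivative -β. This identifies the
η-coefficient of D_X Y with the metric. -/
theorem conormal_flatD (h : IsBlaschkeData φ β θ₀ δ η₀) (hf : IsImmersedSurface f)
    (hfφ : ∀ p, φ (f p) = 0) (hV : IsOpen V) {Y : Field M} (hY : SmoothFieldOn V Y) {q : M}
    (hq : q ∈ V) (x : TangentSpace (𝓡 2) q) :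
    conormal β θ₀ (f q) (flatD f q x Y) = β (deriv4 f q x) (deriv4 f q (Y q)) := by
  have h1 := derivAlong_conormal (β := β) (θ₀ := θ₀) hf
    ((smoothOn_deriv4 hf hV hY).mdifferentiableAt hV hq) x
  rw [show (fun r => conormal β θ₀ (f r) (deriv4 f r (Y r))) = fun _ => 0 from
    funext fun r => conormal_deriv4 h hf hfφ r _, derivAlong_const] at h1
  exact (sub_eq_zero.1 h1.symm)

theorem conormal_deriv4_normal (F : IsAdaptedFrameOn f β θ₀ V X₁ X₂ e)
    (h : IsBlaschkeData φ β θ₀ δ η₀) (hf : IsImmersedSurface f) (hV : IsOpen V) {q : M}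
    (hq : q ∈ V) (x : TangentSpace (𝓡 2) q) : conormal β θ₀ (f q) (deriv4 e q x) = 0 := by
  have h1 := derivAlong_conormal (β := β) (θ₀ := θ₀) hf (F.smooth_normal.mdifferentiableAt hV hq) x
  have h2 : (fun r => conormal β θ₀ (f r) (e r)) =ᶠ[𝓝 q] fun _ => 0 := by
    filter_upwards [hV.mem_nhds hq] with r hr using F.conormal_normal r hr
  rw [derivAlong_congr h2, derivAlong_const, F.normal h hq, sub_zero] at h1
  exact h1.symm

theorem deriv4_normal_normal (F : IsAdaptedFrameOn f β θ₀ V X₁ X₂ e)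
    (h : IsBlaschkeData φ β θ₀ δ η₀) (hV : IsOpen V) {q : M}
    (hq : q ∈ V) (x : TangentSpace (𝓡 2) q) : β (deriv4 e q x) (e q) = 0 := by
  have he := F.smooth_normal.mdifferentiableAt hV hq
  have h1 := derivAlong_bilinear β he he x
  have h2 : (fun r => β (e r) (e r)) =ᶠ[𝓝 q] fun _ => 1 := by
    filter_upwards [hV.mem_nhds hq] with r hr using F.unit_normal r hr
  rw [derivAlong_congr h2, derivAlong_const, h.symm (e q)] at h1
  change 0 = β (deriv4 e q x) (e q) + β (deriv4 e q x) (e q) at h1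
  linarith

/-- Differentiating β(Y, e) = 0 gives the e-coefficient of D_X Y. The field Y may live on a
different open set from e, so that extensions of single vectors can be used. -/
theorem flatD_normal (F : IsAdaptedFrameOn f β θ₀ V X₁ X₂ e)
    (h : IsBlaschkeData φ β θ₀ δ η₀) (hf : IsImmersedSurface f) {q : M} (hqV : V ∈ 𝓝 q)
    {W : Set M} (hW : IsOpen W) {Y : Field M} (hY : SmoothFieldOn W Y)
    (hq : q ∈ W) (x : TangentSpace (𝓡 2) q) :
    β (flatD f q x Y) (e q) = secondForm β f e q x (Y q) := by
  have he : MDifferentiableAt (𝓡 2) 𝓘(ℝ, A4) e q :=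
    (F.smooth_normal.contMDiffAt hqV).mdifferentiableAt (by simp)
  have h1 := derivAlong_bilinear β ((smoothOn_deriv4 hf hW hY).mdifferentiableAt hW hq) he x
  have h2 : (fun r => β (deriv4 f r (Y r)) (e r)) =ᶠ[𝓝 q] fun _ => 0 := by
    filter_upwards [hqV] with r hr using F.normal h hr _
  rw [derivAlong_congr h2, derivAlong_const] at h1
  exact eq_neg_of_add_eq_zero_left h1.symm

theorem secondForm_comm (F : IsAdaptedFrameOn f β θ₀ V X₁ X₂ e)
    (h : IsBlaschkeData φ β θ₀ δ η₀) (hf : IsImmersedSurface f) (hV : IsOpen V) {q : M}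
    (hq : q ∈ V) (x y : TangentSpace (𝓡 2) q) :
    secondForm β f e q x y = secondForm β f e q y x := by
  have key : ∀ x y : TangentSpace (𝓡 2) q, secondForm β f e q x y =
      β (flatD f q x (FiberBundle.extend (EuclideanSpace ℝ (Fin 2)) y)) (e q) := by
    intro x y
    obtain ⟨s, hs, hsy⟩ := FiberBundle.exists_contMDiffOn_extend (k := ∞) (𝓡 2)
      (EuclideanSpace ℝ (Fin 2)) y
    obtain ⟨W, hWs, hW, hqW⟩ := mem_nhds_iff.1 hs
    have h1 := F.flatD_normal h hf (hV.mem_nhds hq) hW (hsy.mono hWs) hqW x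
    rw [FiberBundle.extend_apply_self] at h1
    exact h1.symm
  rw [key, key]
  congr 2
  exact derivAlong_derivAlong_comm (hf.smooth q) y x

end IsAdaptedFrameOn

end AffineSurface

/-! ### The orthogonal plane bundle -/

namespace AffineSurface

variable {M : Type*} [TopologicalSpace M] [ChartedSpace (EuclideanSpace ℝ (Fin 2)) M]
  {φ : A4 → ℝ} {β : A4 →L[ℝ] A4 →L[ℝ] ℝ} {θ₀ : A4 →L[ℝ] ℝ} {δ : ℝ} {η₀ : A4} {f : M → A4}

/-- The plane of vectors `β`-orthogonal to the tangent plane of the surface. -/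
def orthogonalPlane (β : A4 →L[ℝ] A4 →L[ℝ] ℝ) (f : M → A4) (p : M) : Submodule ℝ A4 :=
  ⨅ y : TangentSpace (𝓡 2) p, LinearMap.ker (β (deriv4 f p y) : A4 →ₗ[ℝ] ℝ)

theorem mem_orthogonalPlane {p : M} {w : A4} :
    w ∈ orthogonalPlane β f p ↔ ∀ y, β (deriv4 f p y) w = 0 := by
  simp [orthogonalPlane]

theorem affineNormal_mem_orthogonalPlane (h : IsBlaschkeData φ β θ₀ δ η₀)
    (hf : IsImmersedSurface f) (hfφ : ∀ p, φ (f p) = 0) (p : M) :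
    affineNormal δ η₀ (f p) ∈ orthogonalPlane β f p := by
  rw [mem_orthogonalPlane]
  intro y
  rw [h.symm]
  exact h.orthogonal _ (hfφ p) _ (conormal_deriv4 h hf hfφ p y)

variable [IsManifold (𝓡 2) ∞ M]

namespace IsAdaptedFrameOn

variable {V : Set M} {X₁ X₂ : Field M} {e : M → A4}

theorem orthogonalPlane_eq_span (F : IsAdaptedFrameOn f β θ₀ V X₁ X₂ e)
    (h : IsBlaschkeData φ β θ₀ δ η₀) (hf : IsImmersedSurface f) (hfφ : ∀ p, φ (f p) = 0) {q : M}
    (hq : q ∈ V) :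
    orthogonalPlane β f q = Submodule.span ℝ {e q, affineNormal δ η₀ (f q)} := by
  refine le_antisymm (fun w hw => ?_) (Submodule.span_le.2 ?_)
  · rw [mem_orthogonalPlane] at hw
    rw [Submodule.mem_span_pair]
    have h1 := F.eq_sum h hf hfφ hq w
    rw [h.symm w (deriv4 f q (X₁ q)), h.symm w (deriv4 f q (X₂ q)), hw, hw, zero_smul, zero_smul,
      add_zero, zero_add] at h1
    exact ⟨_, _, h1.symm⟩
  · rintro w (rfl | rfl)
    · exact mem_orthogonalPlane.2 (F.normal h hq)
    · exact affineNormal_mem_orthogonalPlane h hf hfφ q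

theorem isCompl_orthogonalPlane (F : IsAdaptedFrameOn f β θ₀ V X₁ X₂ e)
    (h : IsBlaschkeData φ β θ₀ δ η₀) (hf : IsImmersedSurface f) (hfφ : ∀ p, φ (f p) = 0) {q : M}
    (hq : q ∈ V) : IsCompl (tangentPlane f q) (orthogonalPlane β f q) := by
  constructor
  · rw [Submodule.disjoint_def]
    rintro w hw hw'
    obtain ⟨y, rfl⟩ := mem_tangentPlane.1 hw
    rw [mem_orthogonalPlane] at hw'
    by_contra hy
    exact (deriv4_pos h hf hfφ (hf.deriv4_eq_zero.not.1 hy)).ne' (hw' y)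
  · rw [Submodule.codisjoint_iff_exists_add_eq]
    intro w
    refine ⟨_, _, ?_, ?_, ((F.eq_sum h hf hfφ hq w).trans (add_assoc _ _ _)).symm⟩
    · exact add_mem (Submodule.smul_mem _ _ (mem_tangentPlane.2 ⟨_, rfl⟩))
        (Submodule.smul_mem _ _ (mem_tangentPlane.2 ⟨_, rfl⟩))
    · rw [F.orthogonalPlane_eq_span h hf hfφ hq]
      exact Submodule.mem_span_pair.2 ⟨_, _, rfl⟩

end IsAdaptedFrameOn

theorem isTransversalPlaneBundle_orthogonalPlane (h : IsBlaschkeData φ β θ₀ δ η₀)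
    (hf : IsImmersedSurface f) (hfφ : ∀ p, φ (f p) = 0) {U : Set M} (hU : IsOpen U) :
    IsTransversalPlaneBundle f U (orthogonalPlane β f) := by
  constructor
  · intro p hp
    obtain ⟨V, X₁, X₂, e, -, hpV, -, F⟩ := exists_adaptedFrameOn h hf hfφ hU hp
    exact F.isCompl_orthogonalPlane h hf hfφ hpV
  · intro p hp
    obtain ⟨V, X₁, X₂, e, hV, hpV, hVU, F⟩ := exists_adaptedFrameOn h hf hfφ hU hp
    exact ⟨V, hV, hpV, hVU, e, _, F.smooth_normal, smoothOn_affineNormal hf δ η₀ V,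
      fun q hq => F.orthogonalPlane_eq_span h hf hfφ hq⟩

/-- The connection induced by the orthogonal plane is metric. -/
theorem deriv4_inducedConnection_orthogonalPlane (h : IsBlaschkeData φ β θ₀ δ η₀)
    (hf : IsImmersedSurface f) (hfφ : ∀ p, φ (f p) = 0) (X Y : Field M) (p : M)
    (z : TangentSpace (𝓡 2) p) :
    β (deriv4 f p (inducedConnection f (orthogonalPlane β f) X Y p)) (deriv4 f p z) =
      β (flatD f p (X p) Y) (deriv4 f p z) := by
  have hc := (isTransversalPlaneBundle_orthogonalPlane h hf hfφ isOpen_univ).isCompl p trivial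
  have h1 := mem_orthogonalPlane.1 (sub_tangentialPart_mem hc (flatD f p (X p) Y)) z
  rw [h.symm, map_sub, sub_apply, sub_eq_zero] at h1
  exact h1.symm

/-- The tangential projection is β-orthogonal, so passing from D_X Y to its tangential part changes
no product with a tangent vector. -/
theorem nablaMetric_orthogonalPlane (h : IsBlaschkeData φ β θ₀ δ η₀)
    (hf : IsImmersedSurface f) (hfφ : ∀ p, φ (f p) = 0) {g : FormField M}
    {V : Set M} (hV : IsOpen V) (hg : ∀ q ∈ V, ∀ y z, g q y z = β (deriv4 f q y) (deriv4 f q z))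
    {X Y Z : Field M} (hY : SmoothFieldOn V Y) (hZ : SmoothFieldOn V Z) {p : M} (hp : p ∈ V) :
    nablaMetric f (orthogonalPlane β f) g X Y Z p = 0 := by
  have h1 := deriv4_inducedConnection_orthogonalPlane h hf hfφ
  rw [nablaMetric_eq hf hV hg hY hZ hp, h.symm (deriv4 f p (Y p))]
  simp only [map_sub, sub_apply, h1]
  ring

theorem nablaMetric_areaForm_orthogonalPlane (h : IsBlaschkeData φ β θ₀ δ η₀)
    (hf : IsImmersedSurface f) (hfφ : ∀ p, φ (f p) = 0) {g : FormField M}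
    {V : Set M} (hV : IsOpen V) (hg : ∀ q ∈ V, ∀ y z, g q y z = β (deriv4 f q y) (deriv4 f q z))
    {X₁ X₂ : Field M} (hX : IsOrthonormalFrameOn g V X₁ X₂)
    {X Y Z : Field M} (hY : SmoothFieldOn V Y) (hZ : SmoothFieldOn V Z) {p : M} (hp : p ∈ V) :
    nablaMetric f (orthogonalPlane β f) (areaForm g X₁ X₂) X Y Z p = 0 := by
  have hconn := deriv4_inducedConnection_orthogonalPlane h hf hfφ
  have hd : ∀ {Y : Field M}, SmoothFieldOn V Y →
      MDifferentiableAt (𝓡 2) 𝓘(ℝ, A4) (fun q => deriv4 f q (Y q)) p :=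
    fun hY => (smoothOn_deriv4 hf hV hY).mdifferentiableAt hV hp
  have hdb : ∀ {Y Z : Field M}, SmoothFieldOn V Y → SmoothFieldOn V Z →
      MDifferentiableAt (𝓡 2) 𝓘(ℝ, ℝ) (fun q => β (deriv4 f q (Y q)) (deriv4 f q (Z q))) p :=
    fun hY hZ => ((contMDiffOn_bilin β (smoothOn_deriv4 hf hV hY)
      (smoothOn_deriv4 hf hV hZ)).contMDiffAt (hV.mem_nhds hp)).mdifferentiableAt (by simp)
  have hdbeq : ∀ {Y Z : Field M}, SmoothFieldOn V Y → SmoothFieldOn V Z → ∀ x,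
      derivAlong (fun q => β (deriv4 f q (Y q)) (deriv4 f q (Z q))) p x =
        β (flatD f p x Y) (deriv4 f p (Z p)) + β (flatD f p x Z) (deriv4 f p (Y p)) := by
    intro Y Z hY hZ x
    rw [derivAlong_bilinear β (hd hY) (hd hZ), h.symm (deriv4 f p (Y p))]
    rfl
  have hdm : ∀ {a b c d : M → ℝ}, MDifferentiableAt (𝓡 2) 𝓘(ℝ, ℝ) a p →
      MDifferentiableAt (𝓡 2) 𝓘(ℝ, ℝ) b p → MDifferentiableAt (𝓡 2) 𝓘(ℝ, ℝ) c p →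
      MDifferentiableAt (𝓡 2) 𝓘(ℝ, ℝ) d p → ∀ x,
      derivAlong (fun q => a q * b q - c q * d q) p x =
        derivAlong a p x * b p + a p * derivAlong b p x -
          (derivAlong c p x * d p + c p * derivAlong d p x) := by
    intro a b c d ha hb hc hd x
    have h1 := derivAlong_bilinear (ContinuousLinearMap.mul ℝ ℝ) ha hb x
    have h2 := derivAlong_bilinear (ContinuousLinearMap.mul ℝ ℝ) hc hd x
    exact (derivAlong_sub (ha.mul hb) (hc.mul hd) x).trans (congrArg₂ _ h1 h2)
  have h1 : (fun q => areaForm g X₁ X₂ q (Y q) (Z q)) =ᶠ[𝓝 p] fun q =>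
      β (deriv4 f q (Y q)) (deriv4 f q (X₁ q)) * β (deriv4 f q (Z q)) (deriv4 f q (X₂ q)) -
      β (deriv4 f q (Y q)) (deriv4 f q (X₂ q)) * β (deriv4 f q (Z q)) (deriv4 f q (X₁ q)) := by
    filter_upwards [hV.mem_nhds hp] with q hq
    simp only [areaForm, hg q hq]
  have hs₁ := hX.smooth₁
  have hs₂ := hX.smooth₂
  rw [nablaMetric, deriv1_eq_derivAlong, derivAlong_congr h1,
    hdm (hdb hY hs₁) (hdb hZ hs₂) (hdb hY hs₂) (hdb hZ hs₁), hdbeq hY hs₁, hdbeq hY hs₂,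
    hdbeq hZ hs₁, hdbeq hZ hs₂]
  simp only [areaForm, hg p hp, hconn]
  have hu₁ : ∀ q ∈ V, β (deriv4 f q (X₁ q)) (deriv4 f q (X₁ q)) = 1 := fun q hq => by
    rw [← hg q hq]; exact hX.unit₁ q hq
  have hu₂ : ∀ q ∈ V, β (deriv4 f q (X₂ q)) (deriv4 f q (X₂ q)) = 1 := fun q hq => by
    rw [← hg q hq]; exact hX.unit₂ q hq
  have hu₁₂ : ∀ q ∈ V, β (deriv4 f q (X₁ q)) (deriv4 f q (X₂ q)) = 0 := fun q hq => by
    rw [← hg q hq]; exact hX.orthogonal q hq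
  have hcst : ∀ {u : M → ℝ} {c : ℝ}, (∀ q ∈ V, u q = c) → ∀ x, derivAlong u p x = 0 := by
    intro u c hu x
    have : u =ᶠ[𝓝 p] fun _ => c := by filter_upwards [hV.mem_nhds hp] with q hq using hu q hq
    rw [derivAlong_congr this, derivAlong_const]
  have e₁ := hdbeq hs₁ hs₁ (X p)
  have e₂ := hdbeq hs₂ hs₂ (X p)
  have e₁₂ := hdbeq hs₁ hs₂ (X p)
  rw [hcst hu₁] at e₁
  rw [hcst hu₂] at e₂
  rw [hcst hu₁₂] at e₁₂
  -- After expansion in the frame only the products of D_X X_i with X_j remain. Orthonormality makes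
  -- this matrix skew, and the terms cancel.
  have hspan : ∀ y : TangentSpace (𝓡 2) p, deriv4 f p y =
      β (deriv4 f p y) (deriv4 f p (X₁ p)) • deriv4 f p (X₁ p) +
      β (deriv4 f p y) (deriv4 f p (X₂ p)) • deriv4 f p (X₂ p) := by
    intro y
    have hs : β (deriv4 f p (X₂ p)) (deriv4 f p (X₁ p)) = 0 := by rw [h.symm, hu₁₂ p hp]
    obtain ⟨a, b, rfl⟩ :=
      exists_tangent_eq_of_orthonormal h.symm (hu₁ p hp) (hu₂ p hp) (hu₁₂ p hp) y
    rw [deriv4_add, deriv4_smul, deriv4_smul]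
    simp [hu₁ p hp, hu₂ p hp, hu₁₂ p hp, hs]
  have hexp : ∀ (w : A4) (y : TangentSpace (𝓡 2) p), β w (deriv4 f p y) =
      β (deriv4 f p y) (deriv4 f p (X₁ p)) * β w (deriv4 f p (X₁ p)) +
      β (deriv4 f p y) (deriv4 f p (X₂ p)) * β w (deriv4 f p (X₂ p)) := by
    intro w y
    conv_lhs => rw [hspan y]
    simp
  rw [hexp (flatD f p (X p) X₁) (Y p), hexp (flatD f p (X p) X₂) (Y p),
    hexp (flatD f p (X p) X₁) (Z p), hexp (flatD f p (X p) X₂) (Z p)]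
  generalize β (flatD f p (X p) X₁) (deriv4 f p (X₁ p)) = c₁₁ at *
  generalize β (flatD f p (X p) X₁) (deriv4 f p (X₂ p)) = c₁₂ at *
  generalize β (flatD f p (X p) X₂) (deriv4 f p (X₁ p)) = c₂₁ at *
  generalize β (flatD f p (X p) X₂) (deriv4 f p (X₂ p)) = c₂₂ at *
  have z₁ : c₁₁ = 0 := by linarith
  have z₂ : c₂₂ = 0 := by linarith
  have z₁₂ : c₂₁ = -c₁₂ := by linarith
  rw [z₁, z₂, z₁₂]
  ring

theorem isEquiaffine_orthogonalPlane (h : IsBlaschkeData φ β θ₀ δ η₀)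
    (hf : IsImmersedSurface f) (hfφ : ∀ p, φ (f p) = 0) {g : FormField M}
    {U : Set M} (hU : IsOpen U) (hg : ∀ q ∈ U, ∀ y z, g q y z = β (deriv4 f q y) (deriv4 f q z)) :
    IsEquiaffine f U g (orthogonalPlane β f) where
  toIsTransversalPlaneBundle := isTransversalPlaneBundle_orthogonalPlane h hf hfφ hU
  parallel _ _ _ hV hVU hX _ _ _ _ hY hZ _ hp :=
    nablaMetric_areaForm_orthogonalPlane h hf hfφ hV (fun q hq => hg q (hVU hq)) hX hY hZ hp

theorem isSymmetricEquiaffine_orthogonalPlane (h : IsBlaschkeData φ β θ₀ δ η₀)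
    (hf : IsImmersedSurface f) (hfφ : ∀ p, φ (f p) = 0) {g : FormField M}
    {U : Set M} (hU : IsOpen U) (hg : ∀ q ∈ U, ∀ y z, g q y z = β (deriv4 f q y) (deriv4 f q z)) :
    IsSymmetricEquiaffine f U g (orthogonalPlane β f) where
  toIsEquiaffine := isEquiaffine_orthogonalPlane h hf hfφ hU hg
  symmetric _ _ _ hV hVU hX _ hp := by
    have hn := fun {X Y Z : Field M} => nablaMetric_orthogonalPlane (X := X) (Y := Y) (Z := Z) h hf hfφ
      hV (fun q hq => hg q (hVU hq))
    rw [hn hX.smooth₁ hX.smooth₁ hp, hn hX.smooth₂ hX.smooth₁ hp, hn hX.smooth₂ hX.smooth₂ hp,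
      hn hX.smooth₁ hX.smooth₂ hp, sub_zero]
    exact ⟨rfl, rfl⟩

theorem isAntisymmetricEquiaffine_orthogonalPlane (h : IsBlaschkeData φ β θ₀ δ η₀)
    (hf : IsImmersedSurface f) (hfφ : ∀ p, φ (f p) = 0) {g : FormField M}
    {U : Set M} (hU : IsOpen U) (hg : ∀ q ∈ U, ∀ y z, g q y z = β (deriv4 f q y) (deriv4 f q z)) :
    IsAntisymmetricEquiaffine f U g (orthogonalPlane β f) where
  toIsEquiaffine := isEquiaffine_orthogonalPlane h hf hfφ hU hg
  antisymmetric _ _ _ hV hVU hX _ hp := by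
    have hn := fun {X Y Z : Field M} => nablaMetric_orthogonalPlane (X := X) (Y := Y) (Z := Z) h hf hfφ
      hV (fun q hq => hg q (hVU hq))
    rw [hn hX.smooth₁ hX.smooth₁ hp, hn hX.smooth₂ hX.smooth₁ hp, hn hX.smooth₂ hX.smooth₂ hp,
      hn hX.smooth₁ hX.smooth₂ hp, add_zero]
    exact ⟨rfl, rfl⟩

end AffineSurface

/-! ### Arbitrary symmetric or antisymmetric equiaffine bundles -/

namespace AffineSurface

/-- The first two equations are the equiaffine condition along the two frame fields; the
alternatives are the symmetric and the antisymmetric condition. In either case eliminating t₁, t₂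
gives a linear system for s₁, s₂ with determinant ±(4b² + (a - c)²), which vanishes exactly when II
is a multiple of the metric. -/
theorem frame_system {a b c s₁ s₂ t₁ t₂ : ℝ} (h₁ : a * s₁ + t₁ + b * s₂ = 0)
    (h₂ : b * s₁ + c * s₂ + t₂ = 0)
    (h : (b * s₁ - a * s₂ - t₂ = 0 ∧ b * s₂ - c * s₁ - t₁ = 0) ∨
      (3 * b * s₁ + a * s₂ + t₂ = 0 ∧ 3 * b * s₂ + c * s₁ + t₁ = 0)) :
    (s₁ = 0 ∧ s₂ = 0 ∧ t₁ = 0 ∧ t₂ = 0) ∨ (a = c ∧ b = 0 ∧ t₁ = -(a * s₁) ∧ t₂ = -(a * s₂)) := by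
  by_cases hD : 4 * b ^ 2 + (a - c) ^ 2 = 0
  · have hb : b = 0 := by nlinarith [sq_nonneg b, sq_nonneg (a - c)]
    have hac : a = c := by
      have : (a - c) ^ 2 = 0 := by nlinarith [sq_nonneg b, sq_nonneg (a - c)]
      exact sub_eq_zero.1 (pow_eq_zero_iff two_ne_zero |>.1 this)
    subst hb hac
    exact Or.inr ⟨rfl, rfl, by linarith, by linarith⟩
  · left
    have hs : s₁ = 0 ∧ s₂ = 0 := by
      rcases h with ⟨h₃, h₄⟩ | ⟨h₃, h₄⟩
      · constructor <;> refine (mul_eq_zero.1 ?_).resolve_left hD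
        · linear_combination 2 * b * h₂ + 2 * b * h₃ + (a - c) * h₁ + (a - c) * h₄
        · linear_combination 2 * b * h₁ + 2 * b * h₄ - (a - c) * h₂ - (a - c) * h₃
      · constructor <;> refine (mul_eq_zero.1 ?_).resolve_left hD
        · linear_combination 2 * b * h₃ - 2 * b * h₂ - (a - c) * h₄ + (a - c) * h₁
        · linear_combination 2 * b * h₄ - 2 * b * h₁ + (a - c) * h₃ - (a - c) * h₂
    obtain ⟨rfl, rfl⟩ := hs
    exact ⟨rfl, rfl, by linarith, by linarith⟩

variable {M : Type*} [TopologicalSpace M] [ChartedSpace (EuclideanSpace ℝ (Fin 2)) M]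
  [IsManifold (𝓡 2) ∞ M]
  {φ : A4 → ℝ} {β : A4 →L[ℝ] A4 →L[ℝ] ℝ} {θ₀ : A4 →L[ℝ] ℝ} {δ : ℝ} {η₀ : A4} {f : M → A4}

namespace IsAdaptedFrameOn

variable {V : Set M} {X₁ X₂ : Field M} {e : M → A4}

theorem eq_zero_of_orthogonal (F : IsAdaptedFrameOn f β θ₀ V X₁ X₂ e)
    (h : IsBlaschkeData φ β θ₀ δ η₀) {q : M} (hq : q ∈ V) {y : TangentSpace (𝓡 2) q}
    (h₁ : β (deriv4 f q y) (deriv4 f q (X₁ q)) = 0)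
    (h₂ : β (deriv4 f q y) (deriv4 f q (X₂ q)) = 0) : y = 0 := by
  obtain ⟨a, b, rfl⟩ := F.exists_tangent_eq h hq y
  rw [deriv4_add, deriv4_smul, deriv4_smul] at h₁ h₂
  simp [F.unit₁ q hq, F.unit₂ q hq, F.orthogonal q hq,
    h.symm (deriv4 f q (X₂ q)) (deriv4 f q (X₁ q))] at h₁ h₂
  simp [h₁, h₂]

theorem isOrthonormalFrameOn (F : IsAdaptedFrameOn f β θ₀ V X₁ X₂ e) {g : FormField M}
    (hg : ∀ q ∈ V, ∀ y z, g q y z = β (deriv4 f q y) (deriv4 f q z)) :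
    IsOrthonormalFrameOn g V X₁ X₂ where
  smooth₁ := F.smooth₁
  smooth₂ := F.smooth₂
  unit₁ q hq := (hg q hq _ _).trans (F.unit₁ q hq)
  unit₂ q hq := (hg q hq _ _).trans (F.unit₂ q hq)
  orthogonal q hq := (hg q hq _ _).trans (F.orthogonal q hq)

/-- The normal part of `D_x Y` in the decomposition `T M ⊕ σ`, for an arbitrary transversal `σ`. -/
theorem flatD_sub_tangentialPart (F : IsAdaptedFrameOn f β θ₀ V X₁ X₂ e)
    (h : IsBlaschkeData φ β θ₀ δ η₀) (hf : IsImmersedSurface f) (hfφ : ∀ p, φ (f p) = 0)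
    (hV : IsOpen V) {σ : M → Submodule ℝ A4} {q : M} (hq : q ∈ V)
    (hσ : IsCompl (tangentPlane f q) (σ q)) {Y : Field M} (hY : SmoothFieldOn V Y)
    (x : TangentSpace (𝓡 2) q) :
    flatD f q x Y - deriv4 f q (tangentialPart f σ q (flatD f q x Y)) =
      secondForm β f e q x (Y q) • (e q - deriv4 f q (tangentialPart f σ q (e q))) +
      β (deriv4 f q x) (deriv4 f q (Y q)) • (affineNormal δ η₀ (f q) -
        deriv4 f q (tangentialPart f σ q (affineNormal δ η₀ (f q)))) := by
  have h1 := F.eq_sum h hf hfφ hq (flatD f q x Y)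
  rw [F.flatD_normal h hf (hV.mem_nhds hq) hV hY hq, conormal_flatD h hf hfφ hV hY hq] at h1
  rw [h1, ← deriv4_smul, ← deriv4_smul]
  simp only [tangentialPart_add hf hσ, tangentialPart_smul hf hσ, tangentialPart_deriv4 hf hσ,
    deriv4_add, deriv4_smul]
  module

/-- Membership of a vector in σ means that its tangential part along σ vanishes. Since e and η are
orthogonal to the surface, the products of their tangential parts with the frame are the negatives
of the unknowns s_i, t_i of `frame_system`. -/
theorem mem_of_symmetric_or_antisymmetric (F : IsAdaptedFrameOn f β θ₀ V X₁ X₂ e)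
    (h : IsBlaschkeData φ β θ₀ δ η₀) (hf : IsImmersedSurface f) (hfφ : ∀ p, φ (f p) = 0)
    (hV : IsOpen V) {U : Set M} (hVU : V ⊆ U) {g : FormField M}
    (hg : ∀ q ∈ U, ∀ y z, g q y z = β (deriv4 f q y) (deriv4 f q z)) {σ : M → Submodule ℝ A4}
    (hσ : IsSymmetricEquiaffine f U g σ ∨ IsAntisymmetricEquiaffine f U g σ) {q : M} (hq : q ∈ V) :
    (e q ∈ σ q ∧ affineNormal δ η₀ (f q) ∈ σ q) ∨
    (secondForm β f e q (X₁ q) (X₁ q) = secondForm β f e q (X₂ q) (X₂ q) ∧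
      secondForm β f e q (X₁ q) (X₂ q) = 0 ∧
      affineNormal δ η₀ (f q) + secondForm β f e q (X₁ q) (X₁ q) • e q ∈ σ q) := by
  have hσE : IsEquiaffine f U g σ := hσ.elim (fun h => h.toIsEquiaffine) fun h => h.toIsEquiaffine
  have hc := hσE.isCompl q (hVU hq)
  have hgV : ∀ q ∈ V, ∀ y z, g q y z = β (deriv4 f q y) (deriv4 f q z) := fun q hq => hg q (hVU hq)
  have hX := F.isOrthonormalFrameOn hgV
  have hII := F.secondForm_comm h hf hV hq (X₂ q) (X₁ q)
  have hperp := h.symm (deriv4 f q (X₂ q)) (deriv4 f q (X₁ q))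
  rw [F.orthogonal q hq] at hperp
  set a := secondForm β f e q (X₁ q) (X₁ q) with ha
  set b := secondForm β f e q (X₁ q) (X₂ q) with hb
  set c := secondForm β f e q (X₂ q) (X₂ q) with hc_def
  set E := e q - deriv4 f q (tangentialPart f σ q (e q)) with hE
  set N := affineNormal δ η₀ (f q) -
    deriv4 f q (tangentialPart f σ q (affineNormal δ η₀ (f q))) with hN
  have hnabla : ∀ {X Y Z : Field M}, SmoothFieldOn V Y → SmoothFieldOn V Z →
      nablaMetric f σ g X Y Z q =
        (secondForm β f e q (X q) (Y q) * β E (deriv4 f q (Z q)) +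
          β (deriv4 f q (X q)) (deriv4 f q (Y q)) * β N (deriv4 f q (Z q))) +
        (secondForm β f e q (X q) (Z q) * β E (deriv4 f q (Y q)) +
          β (deriv4 f q (X q)) (deriv4 f q (Z q)) * β N (deriv4 f q (Y q))) := by
    intro X Y Z hY hZ
    rw [nablaMetric_eq hf hV hgV hY hZ hq, inducedConnection, inducedConnection,
      F.flatD_sub_tangentialPart h hf hfφ hV hq hc hY, F.flatD_sub_tangentialPart h hf hfφ hV hq hc hZ,
      h.symm (deriv4 f q (Y q))]
    simp [← hE, ← hN]
  -- The area form is 1 on its own frame, so its parallelism says that the connection is trace free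
  -- in the frame. As X₁, X₂ have unit length, the products of D_X X_i with X_i vanish, and the
  -- condition passes to the σ-components.
  have harea : ∀ {X : Field M}, SmoothFieldOn V X →
      (secondForm β f e q (X q) (X₁ q) * β E (deriv4 f q (X₁ q)) +
          β (deriv4 f q (X q)) (deriv4 f q (X₁ q)) * β N (deriv4 f q (X₁ q))) +
        (secondForm β f e q (X q) (X₂ q) * β E (deriv4 f q (X₂ q)) +
          β (deriv4 f q (X q)) (deriv4 f q (X₂ q)) * β N (deriv4 f q (X₂ q))) = 0 := by
    intro X hXs
    have h0 := hσE.parallel V X₁ X₂ hV hVU hX X X₁ X₂ hXs F.smooth₁ F.smooth₂ q hq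
    have hconst : (fun r => areaForm g X₁ X₂ r (X₁ r) (X₂ r)) =ᶠ[𝓝 q] fun _ => 1 := by
      filter_upwards [hV.mem_nhds hq] with r hr
      simp [areaForm, hgV r hr, F.unit₁ r hr, F.unit₂ r hr, F.orthogonal r hr]
    rw [nablaMetric, deriv1_eq_derivAlong, derivAlong_congr hconst, derivAlong_const] at h0
    simp only [areaForm, hgV q hq, F.unit₁ q hq, F.unit₂ q hq, F.orthogonal q hq, hperp] at h0
    have hunit : ∀ {Y : Field M}, SmoothFieldOn V Y →
        (∀ r ∈ V, β (deriv4 f r (Y r)) (deriv4 f r (Y r)) = 1) →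
        β (flatD f q (X q) Y) (deriv4 f q (Y q)) = 0 := by
      intro Y hY hY1
      have hd := (smoothOn_deriv4 hf hV hY).mdifferentiableAt hV hq
      have h1 := derivAlong_bilinear β hd hd (X q)
      have h2 : (fun r => β (deriv4 f r (Y r)) (deriv4 f r (Y r))) =ᶠ[𝓝 q] fun _ => 1 := by
        filter_upwards [hV.mem_nhds hq] with r hr using hY1 r hr
      rw [derivAlong_congr h2, derivAlong_const, h.symm (deriv4 f q (Y q))] at h1
      change 0 = β (flatD f q (X q) Y) (deriv4 f q (Y q)) +
        β (flatD f q (X q) Y) (deriv4 f q (Y q)) at h1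
      linarith
    have e₁ := congrArg (fun w => β w (deriv4 f q (X₁ q)))
      (F.flatD_sub_tangentialPart h hf hfφ hV hq hc F.smooth₁ (X q))
    have e₂ := congrArg (fun w => β w (deriv4 f q (X₂ q)))
      (F.flatD_sub_tangentialPart h hf hfφ hV hq hc F.smooth₂ (X q))
    simp only [map_sub, map_add, map_smul, sub_apply, add_apply, smul_apply, smul_eq_mul,
      hunit F.smooth₁ F.unit₁, hunit F.smooth₂ F.unit₂] at e₁ e₂
    simp only [hE, hN, map_sub, sub_apply]
    simp only [inducedConnection] at h0
    linarith
  have h1 := harea F.smooth₁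
  have h2 := harea F.smooth₂
  simp only [F.unit₁ q hq, F.unit₂ q hq, F.orthogonal q hq, hperp, hII, ← ha, ← hb, ← hc_def] at h1 h2
  have hsys : (b * β E (deriv4 f q (X₁ q)) - a * β E (deriv4 f q (X₂ q)) -
        β N (deriv4 f q (X₂ q)) = 0 ∧ b * β E (deriv4 f q (X₂ q)) - c * β E (deriv4 f q (X₁ q)) -
        β N (deriv4 f q (X₁ q)) = 0) ∨
      (3 * b * β E (deriv4 f q (X₁ q)) + a * β E (deriv4 f q (X₂ q)) +
        β N (deriv4 f q (X₂ q)) = 0 ∧ 3 * b * β E (deriv4 f q (X₂ q)) +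
        c * β E (deriv4 f q (X₁ q)) + β N (deriv4 f q (X₁ q)) = 0) := by
    rcases hσ with hσ | hσ
    · obtain ⟨h3, h4⟩ := hσ.symmetric V X₁ X₂ hV hVU hX q hq
      rw [hnabla F.smooth₁ F.smooth₁, hnabla F.smooth₂ F.smooth₁] at h3
      rw [hnabla F.smooth₂ F.smooth₂, hnabla F.smooth₁ F.smooth₂] at h4
      simp only [F.unit₁ q hq, F.unit₂ q hq, F.orthogonal q hq, hperp, hII, ← ha, ← hb,
        ← hc_def] at h3 h4
      exact Or.inl ⟨by linarith, by linarith⟩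
    · obtain ⟨h3, h4⟩ := hσ.antisymmetric V X₁ X₂ hV hVU hX q hq
      rw [hnabla F.smooth₁ F.smooth₁, hnabla F.smooth₂ F.smooth₁] at h3
      rw [hnabla F.smooth₂ F.smooth₂, hnabla F.smooth₁ F.smooth₂] at h4
      simp only [F.unit₁ q hq, F.unit₂ q hq, F.orthogonal q hq, hperp, hII, ← ha, ← hb,
        ← hc_def] at h3 h4
      exact Or.inr ⟨by linarith, by linarith⟩
  have heX : ∀ y, β (e q) (deriv4 f q y) = 0 := fun y => by rw [h.symm, F.normal h hq]
  have hηX : ∀ y, β (affineNormal δ η₀ (f q)) (deriv4 f q y) = 0 := fun y =>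
    h.orthogonal _ (hfφ q) _ (conormal_deriv4 h hf hfφ q y)
  have hEX : ∀ y, β (deriv4 f q (tangentialPart f σ q (e q))) (deriv4 f q y) =
      -β E (deriv4 f q y) := fun y => by simp [hE, heX]
  have hNX : ∀ y, β (deriv4 f q (tangentialPart f σ q (affineNormal δ η₀ (f q)))) (deriv4 f q y) =
      -β N (deriv4 f q y) := fun y => by simp [hN, hηX]
  rcases frame_system (a := a) (b := b) (c := c) (by linarith) (by linarith) hsys with
    ⟨hs₁, hs₂, ht₁, ht₂⟩ | ⟨hac, hb0, ht₁, ht₂⟩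
  · left
    rw [← tangentialPart_eq_zero_iff hf hc, ← tangentialPart_eq_zero_iff hf hc]
    constructor <;> apply F.eq_zero_of_orthogonal h hq
    · rw [hEX, hs₁, neg_zero]
    · rw [hEX, hs₂, neg_zero]
    · rw [hNX, ht₁, neg_zero]
    · rw [hNX, ht₂, neg_zero]
  · right
    refine ⟨hac, hb0, ?_⟩
    rw [← tangentialPart_eq_zero_iff hf hc, tangentialPart_add hf hc, tangentialPart_smul hf hc]
    apply F.eq_zero_of_orthogonal h hq <;> rw [deriv4_add, deriv4_smul]
    · simp only [map_add, map_smul, add_apply, smul_apply, smul_eq_mul, hEX, hNX, ht₁]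
      ring
    · simp only [map_add, map_smul, add_apply, smul_apply, smul_eq_mul, hEX, hNX, ht₂]
      ring

end IsAdaptedFrameOn

end AffineSurface

/-! ### Semiumbilicity -/

namespace AffineSurface

variable {M : Type*} [TopologicalSpace M] [ChartedSpace (EuclideanSpace ℝ (Fin 2)) M]
  {φ : A4 → ℝ} {β : A4 →L[ℝ] A4 →L[ℝ] ℝ} {θ₀ : A4 →L[ℝ] ℝ} {δ : ℝ} {η₀ : A4} {f : M → A4}

/-- A vector lies outside σ when it is independent of two spanning sections, and linear independence
is an open condition. The dimension count makes the two sections independent at p. -/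
theorem IsTransversalPlaneBundle.eventually_notMem {U : Set M} {σ : M → Submodule ℝ A4}
    (hf : IsImmersedSurface f) (hσ : IsTransversalPlaneBundle f U σ) {p : M} (hp : p ∈ U)
    {e : M → A4} (he : ContinuousAt e p) (hep : e p ∉ σ p) : ∀ᶠ q in 𝓝 p, e q ∉ σ q := by
  obtain ⟨V, hV, hpV, hVU, ξ₁, ξ₂, hξ₁, hξ₂, hspan⟩ := hσ.smooth p hp
  have hfin : Module.finrank ℝ (tangentPlane f p) + Module.finrank ℝ (σ p) = 4 := by
    rw [Submodule.finrank_add_eq_of_isCompl (hσ.isCompl p hp), Module.finrank_fin_fun]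
  have hfinT : Module.finrank ℝ (tangentPlane f p) = 2 := by
    let df : EuclideanSpace ℝ (Fin 2) →L[ℝ] A4 := mfderiv (𝓡 2) 𝓘(ℝ, A4) f p
    have := LinearMap.finrank_range_of_inj (f := (df : EuclideanSpace ℝ (Fin 2) →ₗ[ℝ] A4))
      (hf.injective p)
    rw [finrank_euclideanSpace_fin] at this
    exact this
  have hli : LinearIndependent ℝ ![ξ₁ p, ξ₂ p] := by
    rw [linearIndependent_iff_card_eq_finrank_span, Matrix.range_cons, Matrix.range_cons,
      Matrix.range_empty, Set.union_empty, Set.singleton_union, Set.finrank, ← hspan p hpV,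
      Fintype.card_fin]
    omega
  have hli' : LinearIndependent ℝ ![e p, ξ₁ p, ξ₂ p] := by
    refine linearIndependent_finCons.2 ⟨hli, ?_⟩
    rwa [Matrix.range_cons, Matrix.range_cons,
      Matrix.range_empty, Set.union_empty, Set.singleton_union, ← hspan p hpV]
  have hc : ContinuousAt (fun q => ![e q, ξ₁ q, ξ₂ q]) p := by
    refine continuousAt_pi.2 fun i => ?_
    have h₁ := hξ₁.continuousOn.continuousAt (hV.mem_nhds hpV)
    have h₂ := hξ₂.continuousOn.continuousAt (hV.mem_nhds hpV)
    fin_cases i <;> assumption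
  filter_upwards [hc.eventually (hli'.eventually), hV.mem_nhds hpV] with q hq hqV
  have hq' := (linearIndependent_finCons.1 hq).2
  rwa [Matrix.range_cons, Matrix.range_cons, Matrix.range_empty, Set.union_empty,
    Set.singleton_union, ← hspan q hqV] at hq'

variable [IsManifold (𝓡 2) ∞ M]

namespace IsAdaptedFrameOn

variable {V : Set M} {X₁ X₂ : Field M} {e : M → A4}

theorem contMDiffOn_secondForm (F : IsAdaptedFrameOn f β θ₀ V X₁ X₂ e) (hf : IsImmersedSurface f)
    (hV : IsOpen V) {X Y : Field M} (hX : SmoothFieldOn V X) (hY : SmoothFieldOn V Y) :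
    ContMDiffOn (𝓡 2) 𝓘(ℝ, ℝ) ∞ (fun q => secondForm β f e q (X q) (Y q)) V :=
  (contMDiffOn_bilin β (smoothOn_deriv4 hf hV hY)
    (contMDiffOn_derivAlong hV F.smooth_normal hX)).neg

/-- The derivative of e has no component along e or η, so only its tangential part remains, and this
is given by II. -/
theorem deriv4_normal_of_umbilic (F : IsAdaptedFrameOn f β θ₀ V X₁ X₂ e)
    (h : IsBlaschkeData φ β θ₀ δ η₀) (hf : IsImmersedSurface f) (hfφ : ∀ p, φ (f p) = 0)
    (hV : IsOpen V) {q : M} (hq : q ∈ V)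
    (hac : secondForm β f e q (X₁ q) (X₁ q) = secondForm β f e q (X₂ q) (X₂ q))
    (hb : secondForm β f e q (X₁ q) (X₂ q) = 0) (x : TangentSpace (𝓡 2) q) :
    deriv4 e q x = -secondForm β f e q (X₁ q) (X₁ q) • deriv4 f q x := by
  have hb' : secondForm β f e q (X₂ q) (X₁ q) = 0 := by rw [F.secondForm_comm h hf hV hq, hb]
  have key : ∀ x y, β (deriv4 e q x) (deriv4 f q y) = -secondForm β f e q x y := fun x y => by
    rw [secondForm, neg_neg, h.symm]
  obtain ⟨a, b, rfl⟩ := F.exists_tangent_eq h hq x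
  rw [F.eq_sum h hf hfφ hq (deriv4 e q _), F.conormal_deriv4_normal h hf hV hq,
    F.deriv4_normal_normal h hV hq, zero_smul, zero_smul, add_zero, add_zero, deriv4_add,
    deriv4_add, deriv4_smul, deriv4_smul, deriv4_smul, deriv4_smul]
  simp only [map_add, map_smul, add_apply, smul_apply, key, hb, hb', ← hac, smul_eq_mul]
  module

/-- The mean curvature of an open umbilic part of the surface is locally constant. -/
theorem derivAlong_secondForm_eq_zero (F : IsAdaptedFrameOn f β θ₀ V X₁ X₂ e)
    (h : IsBlaschkeData φ β θ₀ δ η₀) (hf : IsImmersedSurface f) (hfφ : ∀ p, φ (f p) = 0)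
    (hV : IsOpen V) {p : M} (hp : p ∈ V)
    (hu : ∀ᶠ q in 𝓝 p, secondForm β f e q (X₁ q) (X₁ q) = secondForm β f e q (X₂ q) (X₂ q) ∧
      secondForm β f e q (X₁ q) (X₂ q) = 0) (x : TangentSpace (𝓡 2) p) :
    derivAlong (fun q => secondForm β f e q (X₁ q) (X₁ q)) p x = 0 := by
  set H : M → ℝ := fun q => secondForm β f e q (X₁ q) (X₁ q)
  have hH : MDifferentiableAt (𝓡 2) 𝓘(ℝ, ℝ) H p :=
    ((F.contMDiffOn_secondForm hf hV F.smooth₁ F.smooth₁).contMDiffAt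
      (hV.mem_nhds hp)).mdifferentiableAt (by simp)
  have he : ContMDiffAt (𝓡 2) 𝓘(ℝ, A4) ∞ e p := F.smooth_normal.contMDiffAt (hV.mem_nhds hp)
  -- Differentiate the umbilic relation D_y e = -H y once more. The second derivatives of e and of f
  -- are symmetric, so dH(z) y = dH(y) z; independent tangent vectors then force dH = 0.
  have hDD : ∀ y z : TangentSpace (𝓡 2) p,
      derivAlong (fun q => derivAlong e q (FiberBundle.extend (EuclideanSpace ℝ (Fin 2)) y q)) p z =
      -(derivAlong H p z • deriv4 f p y + H p • derivAlong (fun q => derivAlong f q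
        (FiberBundle.extend (EuclideanSpace ℝ (Fin 2)) y q)) p z) := by
    intro y z
    obtain ⟨s, hs, hsy⟩ := FiberBundle.exists_contMDiffOn_extend (k := ∞) (𝓡 2)
      (EuclideanSpace ℝ (Fin 2)) y
    obtain ⟨W, hWs, hW, hpW⟩ := mem_nhds_iff.1 hs
    have hd := (smoothOn_deriv4 hf hW (hsy.mono hWs)).mdifferentiableAt hW hpW
    have h1 : (fun q => derivAlong e q (FiberBundle.extend (EuclideanSpace ℝ (Fin 2)) y q)) =ᶠ[𝓝 p]
        fun q => (-ContinuousLinearMap.lsmul ℝ ℝ : ℝ →L[ℝ] A4 →L[ℝ] A4) (H q)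
          (deriv4 f q (FiberBundle.extend (EuclideanSpace ℝ (Fin 2)) y q)) := by
      filter_upwards [hu, hV.mem_nhds hp] with q hq hqV
      rw [← deriv4_eq_derivAlong, F.deriv4_normal_of_umbilic h hf hfφ hV hqV hq.1 hq.2]
      simp [H]
    rw [derivAlong_congr h1, derivAlong_bilinear _ hH hd]
    simp only [neg_apply, ContinuousLinearMap.lsmul_apply, FiberBundle.extend_apply_self, neg_add]
    rfl
  have hsymm : ∀ y z : TangentSpace (𝓡 2) p,
      derivAlong H p z • deriv4 f p y = derivAlong H p y • deriv4 f p z := by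
    intro y z
    have h1 := derivAlong_derivAlong_comm he y z
    rw [hDD, hDD, derivAlong_derivAlong_comm (hf.smooth p) y z] at h1
    exact add_right_cancel (neg_injective h1)
  have h2 : derivAlong H p (X₂ p) = 0 := by
    have := congrArg (fun w => β w (deriv4 f p (X₁ p))) (hsymm (X₁ p) (X₂ p))
    simpa [F.unit₁ p hp, h.symm (deriv4 f p (X₂ p)) (deriv4 f p (X₁ p)), F.orthogonal p hp] using this
  have := congrArg (fun w => β w (deriv4 f p (X₂ p))) (hsymm (X₂ p) x)
  simpa [F.unit₂ p hp, h2] using this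

/-- The section is η + H e if p is umbilic and η otherwise. In the first case it is a section of σ
on all of V, because at non-umbilic points both e and η lie in σ. Its conormal value at p is 1, so
it does not vanish there. -/
theorem isSemiumbilicAt (F : IsAdaptedFrameOn f β θ₀ V X₁ X₂ e)
    (h : IsBlaschkeData φ β θ₀ δ η₀) (hf : IsImmersedSurface f) (hfφ : ∀ p, φ (f p) = 0)
    (hV : IsOpen V) {U : Set M} (hVU : V ⊆ U) {g : FormField M}
    (hg : ∀ q ∈ U, ∀ y z, g q y z = β (deriv4 f q y) (deriv4 f q z)) {σ : M → Submodule ℝ A4}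
    (hσ : IsSymmetricEquiaffine f U g σ ∨ IsAntisymmetricEquiaffine f U g σ) {p : M} (hp : p ∈ V) :
    IsSemiumbilicAt f σ p := by
  have hσE : IsEquiaffine f U g σ := hσ.elim (fun h => h.toIsEquiaffine) fun h => h.toIsEquiaffine
  have hc := hσE.isCompl p (hVU hp)
  have hmem := fun {q : M} (hq : q ∈ V) =>
    F.mem_of_symmetric_or_antisymmetric h hf hfφ hV hVU hg hσ hq
  have hsη := smoothOn_affineNormal hf δ η₀ V
  have hsa := F.contMDiffOn_secondForm hf hV F.smooth₁ F.smooth₁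
  have hsb := F.contMDiffOn_secondForm hf hV F.smooth₁ F.smooth₂
  have hsc := F.contMDiffOn_secondForm hf hV F.smooth₂ F.smooth₂
  set H : M → ℝ := fun q => secondForm β f e q (X₁ q) (X₁ q) with hH
  by_cases hu : H p = secondForm β f e p (X₂ p) (X₂ p) ∧ secondForm β f e p (X₁ p) (X₂ p) = 0
  · have hνθ : conormal β θ₀ (f p) (affineNormal δ η₀ (f p) + H p • e p) = 1 := by
      rw [map_add, map_smul, h.conormal_normal _ (hfφ p), F.conormal_normal p hp, smul_zero, add_zero]
    refine ⟨V, fun q => affineNormal δ η₀ (f q) + H q • e q, hV, hp,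
      hsη.add (SmoothOn.smul hsa F.smooth_normal), fun q hq => ?_,
      fun h0 => zero_ne_one ((map_zero _).symm.trans ((congrArg _ h0.symm).trans hνθ)), -(δ - H p ^ 2), fun x => ?_⟩
    · rcases hmem hq with hm | hm
      · exact add_mem hm.2 (Submodule.smul_mem _ _ hm.1)
      · exact hm.2.2
    · have hHd : MDifferentiableAt (𝓡 2) 𝓘(ℝ, ℝ) H p :=
        (hsa.contMDiffAt (hV.mem_nhds hp)).mdifferentiableAt (by simp)
      have hed := F.smooth_normal.mdifferentiableAt hV hp
      have hD : deriv4 (fun q => affineNormal δ η₀ (f q) + H q • e q) p x =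
          deriv4 f p ((δ - H p ^ 2) • x) + derivAlong H p x • e p := by
        rw [deriv4_eq_derivAlong, derivAlong_add (hsη.mdifferentiableAt hV hp)
          ((SmoothOn.smul hsa F.smooth_normal).mdifferentiableAt hV hp),
          derivAlong_affineNormal hf, deriv4_smul]
        have h1 := derivAlong_bilinear (ContinuousLinearMap.lsmul ℝ ℝ : ℝ →L[ℝ] A4 →L[ℝ] A4) hHd hed x
        simp only [ContinuousLinearMap.lsmul_apply] at h1
        rw [h1, ← deriv4_eq_derivAlong e, F.deriv4_normal_of_umbilic h hf hfφ hV hp hu.1 hu.2]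
        simp only [hH]
        module
      -- If e p ∉ σ p, the same holds nearby, so σ differs there from the orthogonal plane. All
      -- these points are then umbilic, and H has zero derivative at p.
      have hT : tangentialPart f σ p (derivAlong H p x • e p) = 0 := by
        rw [tangentialPart_eq_zero_iff hf hc]
        by_cases hep : e p ∈ σ p
        · exact Submodule.smul_mem _ _ hep
        · have hev := hσE.toIsTransversalPlaneBundle.eventually_notMem hf (hVU hp)
            (F.smooth_normal.continuousOn.continuousAt (hV.mem_nhds hp)) hep
          rw [F.derivAlong_secondForm_eq_zero h hf hfφ hV hp, zero_smul]
          · exact zero_mem _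
          · filter_upwards [hev, hV.mem_nhds hp] with q hq hqV
            rcases hmem hqV with hm | hm
            · exact absurd hm.1 hq
            · exact ⟨hm.1, hm.2.1⟩
      rw [shapeOperator, hD, tangentialPart_add hf hc, hT, add_zero, tangentialPart_deriv4 hf hc,
        neg_smul]
  -- Being non-umbilic is an open condition, so η is a section of σ on a neighbourhood of p, as a
  -- shape operator requires.
  · have hev : ∀ᶠ q in 𝓝 p, ¬(H q = secondForm β f e q (X₂ q) (X₂ q) ∧
        secondForm β f e q (X₁ q) (X₂ q) = 0) := by
      have hca := hsa.continuousOn.continuousAt (hV.mem_nhds hp)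
      have hcb := hsb.continuousOn.continuousAt (hV.mem_nhds hp)
      have hcc := hsc.continuousOn.continuousAt (hV.mem_nhds hp)
      rw [not_and_or] at hu
      rcases hu with hu | hu
      · filter_upwards [(hca.sub hcc).eventually_ne (sub_ne_zero.2 hu)] with q hq
          using fun h => hq (sub_eq_zero.2 h.1)
      · filter_upwards [hcb.eventually_ne hu] with q hq using fun h => hq h.2
    obtain ⟨W, hWV, hW, hpW⟩ := mem_nhds_iff.1 (Filter.inter_mem hev (hV.mem_nhds hp))
    refine ⟨W, fun q => affineNormal δ η₀ (f q), hW, hpW, smoothOn_affineNormal hf δ η₀ W,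
      fun q hq => ?_, fun h0 => ?_, -δ, fun x => ?_⟩
    · rcases hmem (hWV hq).2 with hm | hm
      · exact hm.2
      · exact absurd ⟨hm.1, hm.2.1⟩ (hWV hq).1
    · simpa [h0] using h.conormal_normal _ (hfφ p)
    · rw [shapeOperator, deriv4_eq_derivAlong, derivAlong_affineNormal hf, ← deriv4_smul,
        tangentialPart_deriv4 hf hc, neg_smul]

end IsAdaptedFrameOn

end AffineSurface

/-! ### The unit normal as a metric field -/

namespace AffineSurface

theorem bracket_add_smul_third (a b c d w : A4) (t : ℝ) :
    bracket a b (c + t • w) d = bracket a b c d + t * bracket a b w d := by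
  simp [bracket, Matrix.det_succ_row_zero, Fin.sum_univ_succ, Fin.succAbove]
  ring

theorem bracket_swap_first (a b c d : A4) : bracket b a c d = -bracket a b c d := by
  simp [bracket, Matrix.det_succ_row_zero, Fin.sum_univ_succ, Fin.succAbove]
  ring

theorem bracket_swap_last (a b c d : A4) : bracket a b d c = -bracket a b c d := by
  simp [bracket, Matrix.det_succ_row_zero, Fin.sum_univ_succ, Fin.succAbove]
  ring

theorem bracket_eq_zero_of_clm {θ : A4 →L[ℝ] ℝ} (hθ : θ ≠ 0) {a b c d : A4} (ha : θ a = 0)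
    (hb : θ b = 0) (hc : θ c = 0) (hd : θ d = 0) : bracket a b c d = 0 := by
  set q : A4 := fun i => θ (Pi.single i 1) with hq
  have key : ∀ w, q ⬝ᵥ w = θ w := by
    intro w
    conv_rhs => rw [← Finset.univ_sum_single w, map_sum]
    refine Finset.sum_congr rfl fun i _ => ?_
    rw [show (Pi.single i (w i) : A4) = w i • Pi.single i 1 by simp [← Pi.single_smul], map_smul,
      smul_eq_mul, mul_comm]
  have hq0 : q ≠ 0 := by
    intro h0
    refine hθ (ContinuousLinearMap.ext fun w => ?_)
    rw [← key, h0, zero_dotProduct, zero_apply]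
  exact bracket_eq_zero_of_dotProduct hq0 (by rw [key, ha]) (by rw [key, hb]) (by rw [key, hc])
    (by rw [key, hd])

variable {M : Type*} [TopologicalSpace M] [ChartedSpace (EuclideanSpace ℝ (Fin 2)) M]
  {φ : A4 → ℝ} {β : A4 →L[ℝ] A4 →L[ℝ] ℝ} {θ₀ : A4 →L[ℝ] ℝ} {δ : ℝ} {η₀ : A4} {f : M → A4}

theorem IsBlaschkeData.inducedBlaschkeMetric_eq (h : IsBlaschkeData φ β θ₀ δ η₀)
    (hf : IsImmersedSurface f) (hfφ : ∀ p, φ (f p) = 0) (q : M) (y z : TangentSpace (𝓡 2) q) :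
    inducedBlaschkeMetric f φ q y z = β (deriv4 f q y) (deriv4 f q z) :=
  h.metric _ (hfφ q) _ _ (conormal_deriv4 h hf hfφ q y) (conormal_deriv4 h hf hfφ q z)

variable [IsManifold (𝓡 2) ∞ M]

namespace IsAdaptedFrameOn

variable {V : Set M} {X₁ X₂ : Field M} {e : M → A4}

/-- Subtracting the η-component from D_z Y leaves a vector tangent to the quadric. Together with x₁,
x₂ and e it lies in the kernel of the conormal, so that bracket vanishes. -/
theorem transversalForm_normal (F : IsAdaptedFrameOn f β θ₀ V X₁ X₂ e)
    (h : IsBlaschkeData φ β θ₀ δ η₀) (hf : IsImmersedSurface f) (hfφ : ∀ p, φ (f p) = 0) {q : M}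
    (hq : q ∈ V) (x₁ x₂ y z : TangentSpace (𝓡 2) q) :
    transversalForm f e q x₁ x₂ y z = β (deriv4 f q y) (deriv4 f q z) *
      bracket (deriv4 f q x₁) (deriv4 f q x₂) (affineNormal δ η₀ (f q)) (e q) := by
  obtain ⟨s, hs, hsy⟩ := FiberBundle.exists_contMDiffOn_extend (k := ∞) (𝓡 2)
    (EuclideanSpace ℝ (Fin 2)) y
  obtain ⟨W, hWs, hW, hqW⟩ := mem_nhds_iff.1 hs
  have h1 := conormal_flatD h hf hfφ hW (hsy.mono hWs) hqW z
  rw [FiberBundle.extend_apply_self, h.symm] at h1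
  set D := flatD f q z (FiberBundle.extend (EuclideanSpace ℝ (Fin 2)) y)
  have hη := h.conormal_normal _ (hfφ q)
  have hθ : conormal β θ₀ (f q) ≠ 0 := fun h0 => by simp [h0] at hη
  have h2 : bracket (deriv4 f q x₁) (deriv4 f q x₂)
      (D - β (deriv4 f q y) (deriv4 f q z) • affineNormal δ η₀ (f q)) (e q) = 0 :=
    bracket_eq_zero_of_clm hθ (conormal_deriv4 h hf hfφ q _) (conormal_deriv4 h hf hfφ q _)
      (by rw [map_sub, map_smul, h1, hη, smul_eq_mul, mul_one, sub_self]) (F.conormal_normal q hq)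
  change bracket _ _ D _ = _
  rw [← sub_add_cancel D (β (deriv4 f q y) (deriv4 f q z) •
    affineNormal δ η₀ (f q)), bracket_add_smul_third, h2, zero_add]

theorem gram_eq (F : IsAdaptedFrameOn f β θ₀ V X₁ X₂ e)
    (h : IsBlaschkeData φ β θ₀ δ η₀) (hf : IsImmersedSurface f) (hfφ : ∀ p, φ (f p) = 0) {q : M}
    (hq : q ∈ V) (x₁ x₂ : TangentSpace (𝓡 2) q) :
    β (deriv4 f q x₁) (deriv4 f q x₁) * β (deriv4 f q x₂) (deriv4 f q x₂) -
      β (deriv4 f q x₁) (deriv4 f q x₂) * β (deriv4 f q x₂) (deriv4 f q x₁) =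
      bracket (deriv4 f q x₁) (deriv4 f q x₂) (affineNormal δ η₀ (f q)) (e q) ^ 2 := by
  have hθ : ∀ i, conormal β θ₀ (f q) (![deriv4 f q x₁, deriv4 f q x₂, e q] i) = 0 := by
    intro i
    fin_cases i
    exacts [conormal_deriv4 h hf hfφ q x₁, conormal_deriv4 h hf hfφ q x₂, F.conormal_normal q hq]
  have := h.gram _ (hfφ q) _ hθ
  rw [bracket_swap_last, neg_sq]
  refine Eq.trans ?_ this
  simp [Matrix.det_fin_three, F.normal h hq, F.unit_normal q hq, h.symm (e q)]

theorem isPositiveFrame_iff (F : IsAdaptedFrameOn f β θ₀ V X₁ X₂ e)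
    (h : IsBlaschkeData φ β θ₀ δ η₀) (hf : IsImmersedSurface f) (hfφ : ∀ p, φ (f p) = 0) {q : M}
    (hq : q ∈ V) (x₁ x₂ : TangentSpace (𝓡 2) q) :
    IsPositiveFrame f e q x₁ x₂ ↔
      0 < bracket (deriv4 f q x₁) (deriv4 f q x₂) (affineNormal δ η₀ (f q)) (e q) := by
  constructor
  · intro hpos
    have hX : X₁ q ≠ 0 := fun h0 => by simpa [h0, deriv4_zero] using F.unit₁ q hq
    have := hpos _ hX
    rwa [F.transversalForm_normal h hf hfφ hq, F.unit₁ q hq, one_mul] at this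
  · intro hpos y hy
    rw [F.transversalForm_normal h hf hfφ hq]
    exact mul_pos (deriv4_pos h hf hfφ hy) hpos

theorem exists_isPositiveFrame (F : IsAdaptedFrameOn f β θ₀ V X₁ X₂ e)
    (h : IsBlaschkeData φ β θ₀ δ η₀) (hf : IsImmersedSurface f) (hfφ : ∀ p, φ (f p) = 0) {q : M}
    (hq : q ∈ V) : ∃ x₁ x₂ : TangentSpace (𝓡 2) q, IsPositiveFrame f e q x₁ x₂ := by
  have h1 := F.gram_eq h hf hfφ hq (X₁ q) (X₂ q)
  rw [F.unit₁ q hq, F.unit₂ q hq, F.orthogonal q hq, zero_mul, sub_zero, mul_one] at h1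
  rcases lt_trichotomy (bracket (deriv4 f q (X₁ q)) (deriv4 f q (X₂ q))
    (affineNormal δ η₀ (f q)) (e q)) 0 with h0 | h0 | h0
  · refine ⟨X₂ q, X₁ q, (F.isPositiveFrame_iff h hf hfφ hq _ _).2 ?_⟩
    rw [bracket_swap_first]
    exact neg_pos.2 h0
  · rw [h0] at h1
    norm_num at h1
  · exact ⟨X₁ q, X₂ q, (F.isPositiveFrame_iff h hf hfφ hq _ _).2 h0⟩

theorem isMetricField (F : IsAdaptedFrameOn f β θ₀ V X₁ X₂ e)
    (h : IsBlaschkeData φ β θ₀ δ η₀) (hf : IsImmersedSurface f) (hfφ : ∀ p, φ (f p) = 0) :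
    IsMetricField f V e where
  smooth := F.smooth_normal
  transversal q hq hmem := by
    obtain ⟨y, hy⟩ := mem_tangentPlane.1 hmem
    have h1 := F.normal h hq y
    rw [hy, F.unit_normal q hq] at h1
    exact one_ne_zero h1
  positive _ hq := F.exists_isPositiveFrame h hf hfφ hq

theorem transversalMetric_eq (F : IsAdaptedFrameOn f β θ₀ V X₁ X₂ e)
    (h : IsBlaschkeData φ β θ₀ δ η₀) (hf : IsImmersedSurface f) (hfφ : ∀ p, φ (f p) = 0) {q : M}
    (hq : q ∈ V) : transversalMetric f e q = inducedBlaschkeMetric f φ q := by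
  have hex : ∃ u : TangentSpace (𝓡 2) q × TangentSpace (𝓡 2) q,
      IsPositiveFrame f e q u.1 u.2 := by
    obtain ⟨x₁, x₂, hx⟩ := F.exists_isPositiveFrame h hf hfφ hq
    exact ⟨(x₁, x₂), hx⟩
  funext y z
  rw [h.inducedBlaschkeMetric_eq hf hfφ, transversalMetric, dif_pos hex]
  have hpos := (F.isPositiveFrame_iff h hf hfφ hq _ _).1 hex.choose_spec
  have hgram := F.gram_eq h hf hfφ hq hex.choose.1 hex.choose.2
  simp only [F.transversalForm_normal h hf hfφ hq]
  set α := bracket (deriv4 f q hex.choose.1) (deriv4 f q hex.choose.2)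
    (affineNormal δ η₀ (f q)) (e q)
  -- The form is α times β, and the Gram determinant of β on the frame is α². So the determinant of
  -- the form is α⁴, and its fourth root cancels α.
  have key : ∀ a b c d : ℝ, a * b - c * d = α ^ 2 → a * α * (b * α) - c * α * (d * α) = α ^ 4 :=
    fun a b c d hα => by linear_combination α ^ 2 * hα
  rw [key _ _ _ _ hgram, one_div, show (4 : ℝ) = ((4 : ℕ) : ℝ) by norm_num, Real.pow_rpow_inv_natCast hpos.le (by norm_num),
    mul_div_cancel_right₀ _ hpos.ne']

end IsAdaptedFrameOn

end AffineSurface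

/-! ### The theorem on surfaces in hyperquadrics -/

theorem mainTheorem3 {M : Type*} [TopologicalSpace M]
    [ChartedSpace (EuclideanSpace ℝ (Fin 2)) M] [IsManifold (𝓡 2) ∞ M]
    (f : M → AffineSurface.A4) (hf : AffineSurface.IsImmersedSurface f)
    (φ : AffineSurface.A4 → ℝ) (hφ : AffineSurface.IsLocallyStrictlyConvexHyperquadric φ)
    (hfφ : ∀ p, φ (f p) = 0) :
    (∀ p : M, ∃ (U : Set M) (ξ : M → AffineSurface.A4), IsOpen U ∧ p ∈ U ∧
      AffineSurface.IsMetricField f U ξ ∧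
      ∀ q ∈ U, AffineSurface.transversalMetric f ξ q =
        AffineSurface.inducedBlaschkeMetric f φ q) ∧
    ∀ (U : Set M) (ξ : M → AffineSurface.A4), IsOpen U →
      AffineSurface.IsMetricField f U ξ →
      (∀ q ∈ U, AffineSurface.transversalMetric f ξ q =
        AffineSurface.inducedBlaschkeMetric f φ q) →
      AffineSurface.IsAntisymmetricSemiumbilical f U (AffineSurface.transversalMetric f ξ) ∧
      AffineSurface.IsSymmetricSemiumbilical f U (AffineSurface.transversalMetric f ξ) := by
  classical
  -- If M is empty the quadric may be empty too and provide no Blaschke data; every condition is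
  -- then vacuous, so ⊥ serves as the bundle.
  rcases isEmpty_or_nonempty M with hM | ⟨⟨p₀⟩⟩
  · refine ⟨fun p => hM.elim p, fun U ξ _ _ _ => ⟨⟨⟨fun _ => ⊥, ?_⟩, fun _ _ p => hM.elim p⟩,
      ⟨⟨fun _ => ⊥, ?_⟩, fun _ _ p => hM.elim p⟩⟩⟩
    · exact ⟨⟨⟨fun p => hM.elim p, fun p => hM.elim p⟩,
        fun _ _ _ _ _ _ _ _ _ _ _ _ p => hM.elim p⟩, fun _ _ _ _ _ _ p => hM.elim p⟩
    · exact ⟨⟨⟨fun p => hM.elim p, fun p => hM.elim p⟩,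
        fun _ _ _ _ _ _ _ _ _ _ _ _ p => hM.elim p⟩, fun _ _ _ _ _ _ p => hM.elim p⟩
  obtain ⟨β, θ₀, δ, η₀, h⟩ := hφ.exists_blaschkeData ⟨f p₀, hfφ p₀⟩
  refine ⟨fun p => ?_, fun U ξ hU _ hξ => ?_⟩
  · obtain ⟨V, X₁, X₂, e, hV, hp, -, F⟩ :=
      AffineSurface.exists_adaptedFrameOn h hf hfφ isOpen_univ (Set.mem_univ p)
    exact ⟨V, e, hV, hp, F.isMetricField h hf hfφ, fun q hq => F.transversalMetric_eq h hf hfφ hq⟩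
  · have hg : ∀ q ∈ U, ∀ y z, AffineSurface.transversalMetric f ξ q y z =
        β (AffineSurface.deriv4 f q y) (AffineSurface.deriv4 f q z) := fun q hq y z => by
      rw [hξ q hq, h.inducedBlaschkeMetric_eq hf hfφ]
    have hsemi : ∀ σ, (AffineSurface.IsSymmetricEquiaffine f U
        (AffineSurface.transversalMetric f ξ) σ ∨ AffineSurface.IsAntisymmetricEquiaffine f U
        (AffineSurface.transversalMetric f ξ) σ) → ∀ p ∈ U, AffineSurface.IsSemiumbilicAt f σ p := by
      intro σ hσ p hp
      obtain ⟨V, X₁, X₂, e, hV, hpV, hVU, F⟩ :=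
        AffineSurface.exists_adaptedFrameOn h hf hfφ hU hp
      exact F.isSemiumbilicAt h hf hfφ hV hVU hg hσ hpV
    exact ⟨⟨⟨_, AffineSurface.isAntisymmetricEquiaffine_orthogonalPlane h hf hfφ hU hg⟩,
        fun σ hσ => hsemi σ (Or.inr hσ)⟩,
      ⟨⟨_, AffineSurface.isSymmetricEquiaffine_orthogonalPlane h hf hfφ hU hg⟩,
        fun σ hσ => hsemi σ (Or.inl hσ)⟩⟩
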